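/- Identify the plane with $\mathbb C$. For $n\in\mathbb Z_8$ let $c_n=e^{i(5-2n)\pi/8}$, so that $c_0,\dots,c_7$ are the corners, in clockwise order, of a regular octagon $\Gamma_0$ of radius $1$ centred at the origin, and let $F_n(z)=\frac{1}{2+\sqrt2}\bigl(z+(1+\sqrt2)\,c_n\bigr)$. For $m\ge 0$ an $m$-cell is given by a word $w=(j_1,\dots,j_m)\in\mathbb Z_8^m$; its octagon is $F_{j_1}\cdots F_{j_m}(\Gamma_0)$, and its eight sides are the images of the segments $[c_i,c_{i+1}]$, $i\in\mathbb Z_8$. Let $G_m\subset\mathbb C$ be the union of the $8^m$ (filled) octagons of the $m$-cells. The level-$m$ approximation of the projective octagasket is obtained from $G_m$ by identifying antipodally the boundary of every connected component of $\mathbb C\setminus G_m$ (these components are the holes enclosed by the inner boundaries of cells and of pseudo-cells, and the exterior of the outer boundary). Precisely, two sides $e,e'$ of octagons of $m$-cells are the same edge after identification if $e=e'$, or if there are a connected component $C$ of $\mathbb C\setminus G_m$ and a point $p$ such that $e$ and $e'$ are contained in the boundary of $C$, the point reflection $z\mapsto 2p-z$ maps $C$ onto itself, and it maps $e$ onto $e'$.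 The level-$m$ cell graph $\Gamma_m$ has the $8^m$ $m$-cells as vertices; two different $m$-cells are adjacent if they have an edge in common after identification, that is, if a side of one and a side of the other are the same edge after identification. Let $D_m(u,v)$ be the minimal length of a path from $u$ to $v$ in $\Gamma_m$ and let $d_m=\max_{u,v}D_m(u,v)$ be the diameter of $\Gamma_m$. **Proposition.** For every $m>0$ the graphs $\Gamma_m$ and $\Gamma_{m+1}$ are connected (so that $d_m$ and $d_{m+1}$ are finite), and $$d_{m+1}\le 2d_m+2^m+1 .$$ -/

import Mathlib

/-! # Cell graphs of the projective octagasket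

The plane is `ℂ`. The basic octagon has radius `1` and is centred at the origin; its corners are
labelled by `ZMod 8`, clockwise, starting at the top left corner. -/

namespace ProjectiveOctagasket

/-- Corner `n` of the basic octagon: the point of the unit circle at angle `(5 - 2n)π/8`. -/
noncomputable def corner (n : ZMod 8) : ℂ :=
  Complex.exp ((((5 - 2 * (n.val : ℝ)) * Real.pi / 8 : ℝ) : ℂ) * Complex.I)

/-- The contraction `F_n` of ratio `1 / (2 + √2)` that fixes corner `n`. -/
noncomputable def contraction (n : ZMod 8) (z : ℂ) : ℂ :=
  ((1 / (2 + √2) : ℝ) : ℂ) * (z + ((1 + √2 : ℝ) : ℂ) * corner n)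

/-- The composition `F_{w 0} ∘ F_{w 1} ∘ ⋯ ∘ F_{w (m - 1)}`. -/
noncomputable def wordMap : {m : ℕ} → (Fin m → ZMod 8) → ℂ → ℂ
  | 0, _ => id
  | _ + 1, w => contraction (w 0) ∘ wordMap (Fin.tail w)

/-- The (filled) basic octagon. -/
noncomputable def octagon : Set ℂ := convexHull ℝ (Set.range corner)

/-- The octagon of the `m`-cell with word `w`. -/
noncomputable def cellOctagon {m : ℕ} (w : Fin m → ZMod 8) : Set ℂ := wordMap w '' octagon

/-- The side of the octagon of the `m`-cell `w` that joins its corners `i` and `i + 1`. -/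
noncomputable def cellSide {m : ℕ} (w : Fin m → ZMod 8) (i : ZMod 8) : Set ℂ :=
  wordMap w '' segment ℝ (corner i) (corner (i + 1))

/-- The level-`m` approximation of the octagasket: the union of the `8 ^ m` octagons. -/
noncomputable def region (m : ℕ) : Set ℂ := ⋃ w : Fin m → ZMod 8, cellOctagon w

/-- The antipodal identification of two sides `e`, `e'` of level-`m` octagons. Both lie on the
boundary of one connected component `C` of the complement of the level-`m` approximation, and the
point reflection in the centre of symmetry `p` of `C` (the only `p` whose point reflection
preserves `C`) carries `e` onto `e'`.

The bounded components `C` are the holes enclosed by the inner boundary of a cell (then `p` is the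
centre of that cell) and those enclosed by the inner boundary of a pseudo-cell (then `p` is the
centre of that pseudo-cell). The unbounded component is the exterior of the outer boundary (then
`p` is the origin). -/
def AntipodalSides (m : ℕ) (e e' : Set ℂ) : Prop :=
  ∃ x ∈ (region m)ᶜ, ∃ p : ℂ,
    e ⊆ frontier (connectedComponentIn (region m)ᶜ x) ∧
    e' ⊆ frontier (connectedComponentIn (region m)ᶜ x) ∧
    (fun z : ℂ => 2 * p - z) '' connectedComponentIn (region m)ᶜ x =
      connectedComponentIn (region m)ᶜ x ∧
    (fun z : ℂ => 2 * p - z) '' e = e'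

/-- Two sides of level-`m` octagons are the same edge of the projective octagasket: they coincide
in the plane, or they are identified antipodally. -/
def SameEdge (m : ℕ) (e e' : Set ℂ) : Prop := e = e' ∨ AntipodalSides m e e'

theorem AntipodalSides.symm {m : ℕ} {e e' : Set ℂ} (h : AntipodalSides m e e') :
    AntipodalSides m e' e := by
  obtain ⟨x, hx, p, he, he', hC, rfl⟩ := h
  exact ⟨x, hx, p, he', he, hC, by simp [Set.image_image]⟩

theorem SameEdge.symm {m : ℕ} {e e' : Set ℂ} (h : SameEdge m e e') : SameEdge m e' e :=
  h.imp Eq.symm AntipodalSides.symm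

/-- The level-`m` cell graph `Γ_m` of the projective octagasket: its vertices are the `8 ^ m`
`m`-cells, and two different cells are adjacent when they have an edge in common after the
identifications. (Multiplicities of edges do not matter for distances.) -/
def cellGraph (m : ℕ) : SimpleGraph (Fin m → ZMod 8) where
  Adj u v := u ≠ v ∧ ∃ i j : ZMod 8, SameEdge m (cellSide u i) (cellSide v j)
  symm := ⟨fun _ _ ⟨hne, i, j, h⟩ => ⟨hne.symm, j, i, h.symm⟩⟩
  loopless := ⟨fun _ h => h.1 rfl⟩

end ProjectiveOctagasket

/-! # The diameters of the cell graphs of the projective octagasket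

The gluing of the octagons is a recursion on words. Side `i` of a cell is glued to side `i + 4` of
another cell, the `partner`; the sides of a child inside its parent are glued within the parent, and
the other sides inherit the gluing of the side of the parent on which they lie. Thus everything
about distances is combinatorics of words (`Linked`, `Near`), once the cell graph, which is defined
by components of the complement of a plane set, is seen to have the links as its edges
(`linked_of_adj`, `adj_of_linked`).

*Geometry.* The octagon of a cell is an intersection of half-planes (`cellHeight`), and the cells of
one level have disjoint interiors. By recursion on the level, each side that is not common to two
cells lies on the boundary of an explicit hole (`IsHole`, `exists_isHole`). In the passage to the
next level the old holes, the exterior included, grow by triangular notches between the children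
along their sides (`IsHole.succ`); each cell gets a central hole (`isHole_centralHole`), and the
notches on the two sides of a common side form a new hole (`isHole_gap`). Each hole is symmetric
under a point reflection that carries side `i` of a cell to side `i + 4` of its partner, and since
the hole or its complement is bounded, this is the only reflection that preserves the hole.

*Refinement.* A path of length `L` between two cells is lifted to their children. Going from a cell
to the next one takes two links, one inside the cell and one across, unless the entry and the exit
are at distance two in the cell; such a delay costs one more link. Keeping track of all the entries
that can be reached at minimal cost shows that after a delay the choice of entries is so large that
no further delay occurs for a while (`potential_step`): with at most two more links in the last
cell, the distance of the children is at most `2 * L + 2 + delay` with `4 * delay ≤ L + 3`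
(`near_child_of_near`).

*Crude bound.* Independently, the diameter of the graph of level `m + 1` is at most `7 * 2 ^ m - 3`
(`near_of_length_eq`). This gives `delay ≤ 2 ^ (m + 1) - 1`, and the estimate follows. -/

namespace ProjectiveOctagasket

/-! ### The gluing of the sides, in terms of words -/

/-- The cell to which side `i` of a cell is glued, and whether the two sides coincide in the plane
(`true`) or are antipodal on the boundary of a component of the complement (`false`). The side of
that cell which is used is always `i + 4`.

A cell is given by its word, read from the innermost letter to the outermost one, so that `n :: P`
is the child of `P` at corner `n`. Relative to its last letter `n`, a child has the sides `n + 2`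
and `n + 5` in common with its two neighbours in `P`, the sides `n + 3` and `n + 4` on the central
hole of `P`, the sides `n` and `n + 1` on side `n` of `P`, and the sides `n + 6` and `n + 7` on
side `n - 1` of `P`. The sides `n + 1` and `n + 6` run along a notch of the boundary of `P`. -/
def partner : List (ZMod 8) → ZMod 8 → Bool × List (ZMod 8)
  | [], _ => (false, [])
  | n :: P, i =>
    if i = n then
      if (partner P n).1 then (true, (n + 5) :: (partner P n).2)
      else (false, (n + 4) :: (partner P n).2)
    else if i = n + 1 then (false, (n + 4) :: (partner P n).2)
    else if i = n + 2 then (true, (n + 1) :: P)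
    else if i = n + 5 then (true, (n + 7) :: P)
    else if i = n + 6 then (false, (n + 4) :: (partner P (n + 7)).2)
    else if i = n + 7 then
      if (partner P (n + 7)).1 then (true, (n + 3) :: (partner P (n + 7)).2)
      else (false, (n + 4) :: (partner P (n + 7)).2)
    else (false, (n + 4) :: P)

section partner

variable (n : ZMod 8) (P : List (ZMod 8))

@[simp] theorem partner_nil (i : ZMod 8) : partner [] i = (false, []) := rfl

theorem partner_zero : partner (n :: P) n =
    if (partner P n).1 then (true, (n + 5) :: (partner P n).2)
    else (false, (n + 4) :: (partner P n).2) := by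
  simp [partner]

theorem partner_one : partner (n :: P) (n + 1) = (false, (n + 4) :: (partner P n).2) := by
  have h : (1 : ZMod 8) ≠ 0 := by decide
  simp [partner, h]

theorem partner_two : partner (n :: P) (n + 2) = (true, (n + 1) :: P) := by
  have h : (2 : ZMod 8) ≠ 0 ∧ (2 : ZMod 8) ≠ 1 := by decide
  simp [partner, h]

theorem partner_three : partner (n :: P) (n + 3) = (false, (n + 4) :: P) := by
  have h : (3 : ZMod 8) ≠ 0 ∧ (3 : ZMod 8) ≠ 1 ∧ (3 : ZMod 8) ≠ 2 ∧ (3 : ZMod 8) ≠ 5 ∧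
    (3 : ZMod 8) ≠ 6 ∧ (3 : ZMod 8) ≠ 7 := by decide
  simp [partner, h]

theorem partner_four : partner (n :: P) (n + 4) = (false, (n + 4) :: P) := by
  have h : (4 : ZMod 8) ≠ 0 ∧ (4 : ZMod 8) ≠ 1 ∧ (4 : ZMod 8) ≠ 2 ∧ (4 : ZMod 8) ≠ 5 ∧
    (4 : ZMod 8) ≠ 6 ∧ (4 : ZMod 8) ≠ 7 := by decide
  simp [partner, h]

theorem partner_five : partner (n :: P) (n + 5) = (true, (n + 7) :: P) := by
  have h : (5 : ZMod 8) ≠ 0 ∧ (5 : ZMod 8) ≠ 1 ∧ (5 : ZMod 8) ≠ 2 := by decide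
  simp [partner, h]

theorem partner_six : partner (n :: P) (n + 6) = (false, (n + 4) :: (partner P (n + 7)).2) := by
  have h : (6 : ZMod 8) ≠ 0 ∧ (6 : ZMod 8) ≠ 1 ∧ (6 : ZMod 8) ≠ 2 ∧ (6 : ZMod 8) ≠ 5 := by decide
  simp [partner, h]

theorem partner_seven : partner (n :: P) (n + 7) =
    if (partner P (n + 7)).1 then (true, (n + 3) :: (partner P (n + 7)).2)
    else (false, (n + 4) :: (partner P (n + 7)).2) := by
  have h : (7 : ZMod 8) ≠ 0 ∧ (7 : ZMod 8) ≠ 1 ∧ (7 : ZMod 8) ≠ 2 ∧ (7 : ZMod 8) ≠ 5 ∧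
    (7 : ZMod 8) ≠ 6 := by decide
  simp [partner, h]

end partner

/-- Every side of a cell is one of eight, counted from its last letter. -/
theorem side_cases (n i : ZMod 8) : i = n ∨ i = n + 1 ∨ i = n + 2 ∨ i = n + 3 ∨ i = n + 4 ∨
    i = n + 5 ∨ i = n + 6 ∨ i = n + 7 := by
  revert n i; decide

theorem partner_symm (u : List (ZMod 8)) (i : ZMod 8) :
    partner (partner u i).2 (i + 4) = ((partner u i).1, u) := by
  induction u generalizing i with
  | nil => rfl
  | cons n P ih =>
    have e8 : (8 : ZMod 8) = 0 := by decide
    rcases side_cases n i with rfl | rfl | rfl | rfl | rfl | rfl | rfl | rfl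
    · rw [partner_zero]
      cases h : (partner P i).1
      · have := ih i
        simp only [Bool.false_eq_true, if_false]
        rw [partner_zero, this]
        simp [add_assoc, h]
        reduce_mod_char
      · have := ih i
        simp only [if_true]
        rw [show i + 4 = (i + 5) + 7 by ring_nf; reduce_mod_char, partner_seven,
          show i + 5 + 7 = i + 4 by ring_nf; reduce_mod_char, this]
        simp [h, add_assoc]
        reduce_mod_char
    · rw [partner_one]
      simp only
      rw [show n + 1 + 4 = (n + 4) + 1 by ring, partner_one, ih n]
      simp [add_assoc]
      reduce_mod_char
    · rw [partner_two]
      simp only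
      rw [show n + 2 + 4 = (n + 1) + 5 by ring, partner_five]
      simp [add_assoc]
      reduce_mod_char
    · rw [partner_three]
      simp only
      rw [show n + 3 + 4 = (n + 4) + 3 by ring, partner_three]
      simp [add_assoc]
      reduce_mod_char
    · rw [partner_four]
      simp only
      rw [partner_four]
      simp [add_assoc]
      reduce_mod_char
    · rw [partner_five]
      simp only
      rw [show n + 5 + 4 = (n + 7) + 2 by ring, partner_two]
      simp [add_assoc]
      reduce_mod_char
    · rw [partner_six]
      simp only
      rw [show n + 6 + 4 = (n + 4) + 6 by ring, partner_six,
        show n + 4 + 7 = n + 7 + 4 by ring, ih (n + 7)]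
      simp [add_assoc]
      reduce_mod_char
    · rw [partner_seven]
      have := ih (n + 7)
      cases h : (partner P (n + 7)).1
      · simp only [Bool.false_eq_true, if_false]
        rw [show n + 7 + 4 = (n + 4) + 7 by ring, partner_seven,
          show n + 4 + 7 = n + 7 + 4 by ring, this]
        simp [add_assoc, h]
        reduce_mod_char
      · simp only [if_true]
        rw [show n + 7 + 4 = n + 3 by ring_nf; reduce_mod_char, partner_zero,
          show n + 3 = n + 7 + 4 by ring_nf; reduce_mod_char, this]
        simp [add_assoc, h]
        reduce_mod_char

theorem length_partner (u : List (ZMod 8)) (i : ZMod 8) : (partner u i).2.length = u.length := by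
  induction u generalizing i with
  | nil => rfl
  | cons n P ih =>
    unfold partner
    split_ifs <;> simp [ih]

/-- Two consecutive sides of a cell do not both coincide with sides of other cells: the angles of
three octagons at a common corner exceed a full turn. -/
theorem not_planar_consecutive (u : List (ZMod 8)) (i : ZMod 8) :
    ¬ ((partner u i).1 = true ∧ (partner u (i + 1)).1 = true) := by
  induction u generalizing i with
  | nil => simp
  | cons n P ih =>
    rintro ⟨h1, h2⟩
    rcases side_cases n i with rfl | rfl | rfl | rfl | rfl | rfl | rfl | rfl
    · simp [partner_one] at h2
    · simp [partner_one] at h1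
    · rw [show n + 2 + 1 = n + 3 by ring, partner_three] at h2; simp at h2
    · simp [partner_three] at h1
    · simp [partner_four] at h1
    · rw [show n + 5 + 1 = n + 6 by ring, partner_six] at h2; simp at h2
    · simp [partner_six] at h1
    · have e : n + 7 + 1 = n := by ring_nf; reduce_mod_char
      have := ih (n + 7)
      rw [e] at h2 this
      rw [partner_zero] at h2
      rw [partner_seven] at h1
      refine this ⟨?_, ?_⟩
      · by_contra h; simp [h] at h1
      · by_contra h; simp [h] at h2

section lift

variable {P : List (ZMod 8)} {i : ZMod 8}

/-! The four pieces into which the boundary of a cell refines a side. -/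

theorem partner_refine_hole (h : (partner P i).1 = false) :
    partner (i :: P) i = (false, (i + 4) :: (partner P i).2) ∧
    partner (i :: P) (i + 1) = (false, (i + 4) :: (partner P i).2) ∧
    partner ((i + 1) :: P) (i + 7) = (false, (i + 5) :: (partner P i).2) ∧
    partner ((i + 1) :: P) i = (false, (i + 5) :: (partner P i).2) := by
  have e : i + 1 + 7 = i := by ring_nf; reduce_mod_char
  refine ⟨by simp [partner_zero, h], partner_one _ _, ?_, ?_⟩
  · rw [show i + 7 = i + 1 + 6 by ring, partner_six, e, add_assoc]; norm_num
  · have := partner_seven (i + 1) P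
    rw [e] at this
    rw [this]; simp [h, add_assoc]; norm_num

theorem partner_refine_planar (h : (partner P i).1 = true) :
    partner (i :: P) i = (true, (i + 5) :: (partner P i).2) ∧
    partner (i :: P) (i + 1) = (false, (i + 4) :: (partner P i).2) ∧
    partner ((i + 1) :: P) (i + 7) = (false, (i + 5) :: (partner P i).2) ∧
    partner ((i + 1) :: P) i = (true, (i + 4) :: (partner P i).2) := by
  have e : i + 1 + 7 = i := by ring_nf; reduce_mod_char
  refine ⟨by simp [partner_zero, h], partner_one _ _, ?_, ?_⟩
  · rw [show i + 7 = i + 1 + 6 by ring, partner_six, e, add_assoc]; norm_num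
  · have := partner_seven (i + 1) P
    rw [e] at this
    rw [this]; simp [h, add_assoc]; norm_num

end lift

/-- Two cells are linked when a side of one is glued to a side of the other. -/
def Linked (u v : List (ZMod 8)) : Prop := ∃ i, (partner u i).2 = v

theorem Linked.symm {u v : List (ZMod 8)} (h : Linked u v) : Linked v u := by
  obtain ⟨i, rfl⟩ := h
  exact ⟨i + 4, by rw [partner_symm]⟩

theorem Linked.length_eq {u v : List (ZMod 8)} (h : Linked u v) : v.length = u.length := by
  obtain ⟨i, rfl⟩ := h
  exact length_partner u i

/-- `Near k u v`: there is a chain of at most `k` links from the cell `u` to the cell `v`. -/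
inductive Near : ℕ → List (ZMod 8) → List (ZMod 8) → Prop
  | refl (k : ℕ) (u : List (ZMod 8)) : Near k u u
  | head {k : ℕ} {u v w : List (ZMod 8)} : Linked u v → Near k v w → Near (k + 1) u w

namespace Near

variable {j k : ℕ} {u v w : List (ZMod 8)}

theorem trans (h₁ : Near j u v) (h₂ : Near k v w) : Near (j + k) u w := by
  induction h₁ with
  | refl j u =>
    induction h₂ generalizing j with
    | refl k u => exact .refl _ _
    | head h _ ih => exact .head h (ih j)
  | head h _ ih => rw [Nat.add_right_comm]; exact .head h (ih h₂)

theorem mono (h : Near j u v) (hjk : j ≤ k) : Near k u v := by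
  have := (Near.refl (k - j) u).trans h
  rwa [Nat.sub_add_cancel hjk] at this

theorem of_linked (h : Linked u v) : Near 1 u v := .head h (.refl 0 v)

theorem of_partner (i : ZMod 8) (h : (partner u i).2 = v) : Near 1 u v := of_linked ⟨i, h⟩

theorem symm (h : Near k u v) : Near k v u := by
  induction h with
  | refl k u => exact .refl k u
  | head h _ ih => exact ih.trans (of_linked h.symm)

theorem length_eq (h : Near k u v) : v.length = u.length := by
  induction h with
  | refl => rfl
  | head h _ ih => rw [ih, h.length_eq]

end Near

/-- The children `q` and `q'` of a cell are linked when `q' = q ± 1` or `q' = q + 4`, so any two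
children are at distance at most two. -/
theorem near_child (P : List (ZMod 8)) (q d : ZMod 8) (hd : d = 1 ∨ d = 4 ∨ d = 7) :
    Near 1 (q :: P) ((q + d) :: P) := by
  rcases hd with rfl | rfl | rfl
  · exact .of_partner (q + 2) (by rw [partner_two])
  · exact .of_partner (q + 4) (by rw [partner_four])
  · exact .of_partner (q + 5) (by rw [partner_five])

/-! ### A crude bound for the distance of two cells -/

/-- All letters of the word `x` are `s` or `s + 1`: the cell `x ++ A` has a side on side `s` of
the octagon of `A`. -/
def Along (s : ZMod 8) (x : List (ZMod 8)) : Prop := ∀ q ∈ x, q = s ∨ q = s + 1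

theorem along_replicate {s q : ZMod 8} (k : ℕ) (h : q = s ∨ q = s + 1) :
    Along s (List.replicate k q) := by
  intro p hp
  rwa [List.eq_of_mem_replicate hp]

theorem Along.add_four {s : ZMod 8} {x : List (ZMod 8)} (h : Along s x) :
    Along (s + 4) (x.map (· + 4)) := by
  intro q hq
  obtain ⟨p, hp, rfl⟩ := List.mem_map.1 hq
  rcases h p hp with rfl | rfl
  · exact .inl rfl
  · exact .inr (by ring)

theorem map_add_four_map_add_four (x : List (ZMod 8)) : (x.map (· + 4)).map (· + 4) = x := by
  have h : ∀ q : ZMod 8, q + 4 + 4 = q := by decide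
  simp [Function.comp_def, h]

theorem partner_append_hole {A : List (ZMod 8)} {i : ZMod 8} (h : (partner A i).1 = false)
    {x : List (ZMod 8)} (hx : Along i x) :
    partner (x ++ A) i = (false, x.map (· + 4) ++ (partner A i).2) := by
  induction x with
  | nil => ext1 <;> simp [h]
  | cons q x ih =>
    have ih := ih fun p hp => hx p (List.mem_cons_of_mem _ hp)
    have h' : (partner (x ++ A) i).1 = false := by rw [ih]
    obtain ⟨h1, -, -, h4⟩ := partner_refine_hole h'
    rcases hx q List.mem_cons_self with rfl | rfl
    · rw [List.cons_append, h1, ih]; simp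
    · rw [List.cons_append, h4, ih]; simp [add_assoc]; norm_num

theorem partner_append_planar {A : List (ZMod 8)} {i : ZMod 8} (h : (partner A i).1 = true)
    {x : List (ZMod 8)} (hx : Along i x) :
    partner (x ++ A) i = (true, x.map (2 * i + 5 - ·) ++ (partner A i).2) := by
  induction x with
  | nil => ext1 <;> simp [h]
  | cons q x ih =>
    have ih := ih fun p hp => hx p (List.mem_cons_of_mem _ hp)
    have h' : (partner (x ++ A) i).1 = true := by rw [ih]
    obtain ⟨h1, -, -, h4⟩ := partner_refine_planar h'
    rcases hx q List.mem_cons_self with rfl | rfl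
    · rw [List.cons_append, h1, ih]; simp; ring
    · rw [List.cons_append, h4, ih]; simp; ring

/-- Straight across a cell: from side `s` to the opposite point of side `s + 4`, hopping over one
central hole after the other. -/
theorem near_opposite (A x : List (ZMod 8)) (s : ZMod 8) (hx : Along s x) :
    Near (2 ^ x.length - 1) (x ++ A) (x.map (· + 4) ++ A) := by
  induction x using List.reverseRecOn generalizing A s with
  | nil => exact .refl _ _
  | append_singleton y w ih =>
    have hy : Along s y := fun q hq => hx q (by simp [hq])
    have hhole : partner (w :: A) (s + 4) = (false, (w + 4) :: A) := by
      rcases hx w (by simp) with rfl | rfl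
      · exact partner_four _ _
      · have := partner_three (s + 1) A
        rwa [show s + 1 + 3 = s + 4 by ring] at this
    have h1 := ih (w :: A) s hy
    have h2 : Near 1 (y.map (· + 4) ++ w :: A) (y ++ (w + 4) :: A) := by
      refine .of_partner (s + 4) ?_
      rw [partner_append_hole (by rw [hhole]) hy.add_four, hhole, map_add_four_map_add_four]
    have h3 := ih ((w + 4) :: A) s hy
    have h := (h1.trans h2).trans h3
    simp only [List.append_assoc, List.singleton_append, List.map_append, List.map_cons,
      List.map_nil, List.length_append, List.length_singleton]
    refine h.mono ?_
    have := Nat.one_le_two_pow (n := y.length)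
    rw [pow_succ]
    omega

theorem near_opposite_replicate (A : List (ZMod 8)) (k : ℕ) (q : ZMod 8) :
    Near (2 ^ k - 1) (List.replicate k q ++ A) (List.replicate k (q + 4) ++ A) := by
  simpa using near_opposite A (List.replicate k q) q (along_replicate k (.inl rfl))

/-- Along a side that two cells `A` and `B` have in common, zigzagging between the two cells: either
end of the side is reached, in `A` or in `B`. Each gap of the common boundary is crossed by the
antipodal identification of the pseudo-cell hole in that gap, which also changes sides. -/
theorem near_end (x : List (ZMod 8)) : ∀ (A B : List (ZMod 8)) (i : ZMod 8),
    partner A i = (true, B) → Along i x →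
    (Near (2 ^ x.length - 1) (x ++ A) (List.replicate x.length i ++ A) ∨
      Near (2 ^ x.length - 1) (x ++ A) (List.replicate x.length (i + 5) ++ B)) ∧
    (Near (2 ^ x.length - 1) (x ++ A) (List.replicate x.length (i + 1) ++ A) ∨
      Near (2 ^ x.length - 1) (x ++ A) (List.replicate x.length (i + 4) ++ B)) := by
  generalize hk : x.length = k
  induction k generalizing x with
  | zero =>
    intro A B i _ _
    obtain rfl := List.length_eq_zero_iff.1 hk
    exact ⟨.inl (.refl _ _), .inl (.refl _ _)⟩
  | succ k ih =>
    intro A B i hAB hx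
    obtain ⟨y, w, rfl⟩ : ∃ y w, x = y ++ [w] :=
      ⟨_, _, (List.dropLast_append_getLast (by rintro rfl; simp at hk)).symm⟩
    have hy : Along i y := fun q hq => hx q (by simp [hq])
    have hyk : y.length = k := by simpa using hk
    obtain ⟨p1, p2, p3, p4⟩ := partner_refine_planar (P := A) (i := i) (by rw [hAB])
    rw [hAB] at p1 p2 p3 p4
    simp only at p1 p2 p3 p4
    have e1 : i + 4 + 5 = i + 1 := by ring_nf; reduce_mod_char
    have e2 : i + 4 + 4 = i := by ring_nf; reduce_mod_char
    have e3 : i + 4 + 1 = i + 5 := by ring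
    have e4 : i + 1 + 4 = i + 5 := by ring
    have e5 : i = i + 7 + 1 := by ring_nf; reduce_mod_char
    have e6 : i + 5 + 4 = i + 1 := by ring_nf; reduce_mod_char
    have p1' : partner ((i + 5) :: B) (i + 4) = (true, i :: A) := by
      have := partner_symm (i :: A) i
      rwa [p1] at this
    have p4' : partner ((i + 4) :: B) (i + 4) = (true, (i + 1) :: A) := by
      have := partner_symm ((i + 1) :: A) i
      rwa [p4] at this
    -- The two ways over the gap between the two halves of the side.
    have g1 : Near 1 (List.replicate k (i + 1) ++ i :: A)
        (List.replicate k (i + 5) ++ (i + 4) :: B) := by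
      refine .of_partner (i + 1) ?_
      rw [partner_append_hole (by rw [p2]) (along_replicate k (.inl rfl)), p2]
      simp [e4]
    have g2 : Near 1 (List.replicate k i ++ (i + 1) :: A)
        (List.replicate k (i + 4) ++ (i + 5) :: B) := by
      refine .of_partner (i + 7) ?_
      rw [partner_append_hole (by rw [p3]) (along_replicate k (.inr e5)), p3]
      simp
    have hpow : 2 ^ (k + 1) - 1 = (2 ^ k - 1) + (1 + (2 ^ k - 1)) := by
      have := Nat.one_le_two_pow (n := k)
      rw [pow_succ]; omega
    have hle : 2 ^ k - 1 ≤ 2 ^ (k + 1) - 1 := by omega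
    have rr : ∀ (q : ZMod 8) (C : List (ZMod 8)),
        List.replicate (k + 1) q ++ C = List.replicate k q ++ q :: C := by
      intro q C; rw [List.replicate_succ']; simp
    simp only [List.append_assoc, List.singleton_append, rr]
    rcases hx w (by simp) with rfl | rfl
    · obtain ⟨h1, h2⟩ := ih y hyk _ _ w p1 hy
      refine ⟨h1.imp (·.mono hle) (·.mono hle), ?_⟩
      rw [hpow]
      rcases h2 with h2 | h2
      · obtain ⟨h3, -⟩ := ih (List.replicate k (w + 5)) (by simp) _ _ (w + 4) p4'
          (along_replicate k (.inr e3.symm))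
        rw [e1] at h3
        exact h3.symm.imp (fun h => h2.trans (g1.trans h)) (fun h => h2.trans (g1.trans h))
      · obtain ⟨-, h3⟩ := ih (List.replicate k w) (by simp) _ _ w p4
          (along_replicate k (.inl rfl))
        exact h3.imp (fun h => h2.trans (g2.symm.trans h)) (fun h => h2.trans (g2.symm.trans h))
    · obtain ⟨h1, h2⟩ := ih y hyk _ _ i p4 hy
      refine ⟨?_, h2.imp (·.mono hle) (·.mono hle)⟩
      rw [hpow]
      rcases h1 with h1 | h1
      · obtain ⟨-, h3⟩ := ih (List.replicate k (i + 4)) (by simp) _ _ (i + 4) p1'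
          (along_replicate k (.inl rfl))
        rw [e2, e3] at h3
        exact h3.symm.imp (fun h => h1.trans (g2.trans h)) (fun h => h1.trans (g2.trans h))
      · obtain ⟨h3, -⟩ := ih (List.replicate k (i + 1)) (by simp) _ _ i p1
          (along_replicate k (.inr rfl))
        exact h3.imp (fun h => h1.trans (g1.symm.trans h)) (fun h => h1.trans (g1.symm.trans h))

/-- The first end of a common side, on either side of it. -/
theorem near_first_end {A B x : List (ZMod 8)} {i : ZMod 8} (h : partner A i = (true, B))
    (hx : Along i x) :
    Near (2 ^ x.length) (x ++ A) (List.replicate x.length i ++ A) ∧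
    Near (2 ^ x.length) (x ++ A) (List.replicate x.length (i + 5) ++ B) := by
  have hsw : Near 1 (List.replicate x.length i ++ A) (List.replicate x.length (i + 5) ++ B) := by
    refine .of_partner i ?_
    rw [partner_append_planar (by rw [h]) (along_replicate _ (.inl rfl)), h]
    simp; ring_nf; simp
  have hp : 2 ^ x.length = (2 ^ x.length - 1) + 1 := (Nat.sub_add_cancel Nat.one_le_two_pow).symm
  rw [hp]
  rcases (near_end x A B i h hx).1 with h1 | h1
  · exact ⟨h1.mono (Nat.le_succ _), h1.trans hsw⟩
  · exact ⟨h1.trans hsw.symm, h1.mono (Nat.le_succ _)⟩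

/-- The second end of a common side, on either side of it. -/
theorem near_second_end {A B x : List (ZMod 8)} {i : ZMod 8} (h : partner A i = (true, B))
    (hx : Along i x) :
    Near (2 ^ x.length) (x ++ A) (List.replicate x.length (i + 1) ++ A) ∧
    Near (2 ^ x.length) (x ++ A) (List.replicate x.length (i + 4) ++ B) := by
  have hsw : Near 1 (List.replicate x.length (i + 1) ++ A)
      (List.replicate x.length (i + 4) ++ B) := by
    refine .of_partner i ?_
    rw [partner_append_planar (by rw [h]) (along_replicate _ (.inr rfl)), h]
    simp; ring_nf; simp
  have hp : 2 ^ x.length = (2 ^ x.length - 1) + 1 := (Nat.sub_add_cancel Nat.one_le_two_pow).symm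
  rw [hp]
  rcases (near_end x A B i h hx).2 with h1 | h1
  · exact ⟨h1.mono (Nat.le_succ _), h1.trans hsw⟩
  · exact ⟨h1.trans hsw.symm, h1.mono (Nat.le_succ _)⟩

/-- From any subcell of `A` to a subcell that has a side on a given side of `A`. The induction is on
the outermost letter `a` of the subcell: the corresponding side of the child `a` is reached first,
then the central hole, or at most one more child, has to be crossed. -/
theorem near_side (A u : List (ZMod 8)) (s : ZMod 8) :
    ∃ x, x.length = u.length ∧ Along s x ∧ Near (2 ^ (u.length + 1) - 2) (u ++ A) (x ++ A) := by
  induction u using List.reverseRecOn generalizing A s with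
  | nil => exact ⟨[], rfl, by simp [Along], .refl _ _⟩
  | append_singleton y a ih =>
    have hpow := Nat.one_le_two_pow (n := y.length)
    simp only [List.append_assoc, List.singleton_append, List.length_append, List.length_singleton]
    have along_snoc : ∀ x b, Along s x → (b = s ∨ b = s + 1) → Along s (x ++ [b]) := by
      intro x b hx hb q hq
      rcases List.mem_append.1 hq with h | h
      · exact hx q h
      · rw [List.mem_singleton.1 h]; exact hb
    have e44 : ∀ t : ZMod 8, t + 4 + 4 = t := by decide
    -- Over the central hole, and straight to the opposite side.
    have hop : ∀ (x : List (ZMod 8)) (a b : ZMod 8), x.length = y.length → Along s x →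
        partner (a :: A) s = (false, b :: A) →
        Near (2 ^ (y.length + 1) - 2) (y ++ a :: A) (x ++ a :: A) →
        Near (2 ^ (y.length + 1 + 1) - 2) (y ++ a :: A) (x ++ b :: A) := by
      intro x a b hxl hx hq hn
      have h1 : Near 1 (x ++ a :: A) (x.map (· + 4) ++ b :: A) := by
        refine .of_partner s ?_
        rw [partner_append_hole (by rw [hq]) hx, hq]
      have h2 := (near_opposite (b :: A) x s hx).symm
      refine ((hn.trans h1).trans h2).mono ?_
      rw [hxl, pow_succ, pow_succ]; omega
    rcases side_cases s a with h | h | h | h | h | h | h | h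
    · obtain ⟨x, hxl, hx, hn⟩ := ih (a :: A) s
      refine ⟨x ++ [a], by simp [hxl], along_snoc _ _ hx (.inl h), ?_⟩
      rw [List.append_assoc]
      exact hn.mono (by rw [pow_succ]; omega)
    · obtain ⟨x, hxl, hx, hn⟩ := ih (a :: A) s
      refine ⟨x ++ [a], by simp [hxl], along_snoc _ _ hx (.inr h), ?_⟩
      rw [List.append_assoc]
      exact hn.mono (by rw [pow_succ]; omega)
    · subst h
      obtain ⟨x, hxl, hx, hn⟩ := ih ((s + 2) :: A) (s + 7)
      have hp : partner ((s + 2) :: A) (s + 7) = (true, (s + 1) :: A) := by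
        have := partner_five (s + 2) A
        rwa [show s + 2 + 5 = s + 7 by ring, show s + 2 + 7 = s + 1 by ring_nf; reduce_mod_char]
          at this
      have h1 := (near_first_end hp hx).2
      rw [show s + 7 + 5 = s + 4 by ring_nf; reduce_mod_char] at h1
      have h2 := near_opposite_replicate ((s + 1) :: A) x.length (s + 4)
      rw [e44] at h2
      refine ⟨List.replicate x.length s ++ [s + 1], by simp [hxl],
        along_snoc _ _ (along_replicate _ (.inl rfl)) (.inr rfl), ?_⟩
      rw [List.append_assoc]
      refine ((hn.trans h1).trans h2).mono ?_
      rw [hxl, pow_succ, pow_succ]; omega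
    · subst h
      obtain ⟨x, hxl, hx, hn⟩ := ih ((s + 3) :: A) (s + 5)
      have hp : partner ((s + 3) :: A) (s + 5) = (true, (s + 4) :: A) := by
        have := partner_two (s + 3) A
        rwa [show s + 3 + 2 = s + 5 by ring, show s + 3 + 1 = s + 4 by ring] at this
      have h1 := (near_second_end hp hx).2
      rw [show s + 5 + 4 = s + 1 by ring_nf; reduce_mod_char] at h1
      have h2 : Near 1 (List.replicate x.length (s + 1) ++ (s + 4) :: A)
          (List.replicate x.length (s + 5) ++ s :: A) := by
        have hq := partner_four (s + 4) A
        rw [e44] at hq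
        refine .of_partner s ?_
        rw [partner_append_hole (by rw [hq]) (along_replicate _ (.inr rfl)), hq]
        simp [add_assoc]; norm_num
      have h3 := near_opposite_replicate (s :: A) x.length (s + 5)
      rw [show s + 5 + 4 = s + 1 by ring_nf; reduce_mod_char] at h3
      refine ⟨List.replicate x.length (s + 1) ++ [s], by simp [hxl],
        along_snoc _ _ (along_replicate _ (.inr rfl)) (.inl rfl), ?_⟩
      rw [List.append_assoc]
      refine (((hn.trans h1).trans h2).trans h3).mono ?_
      rw [hxl, pow_succ, pow_succ]; omega
    · obtain ⟨x, hxl, hx, hn⟩ := ih (a :: A) s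
      subst h
      have hq := partner_four (s + 4) A
      rw [e44] at hq
      refine ⟨x ++ [s], by simp [hxl], along_snoc _ _ hx (.inl rfl), ?_⟩
      rw [List.append_assoc]
      exact hop x (s + 4) s hxl hx hq hn
    · obtain ⟨x, hxl, hx, hn⟩ := ih (a :: A) s
      subst h
      have hq := partner_three (s + 5) A
      rw [show s + 5 + 3 = s by ring_nf; reduce_mod_char,
        show s + 5 + 4 = s + 1 by ring_nf; reduce_mod_char] at hq
      refine ⟨x ++ [s + 1], by simp [hxl], along_snoc _ _ hx (.inr rfl), ?_⟩
      rw [List.append_assoc]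
      exact hop x (s + 5) (s + 1) hxl hx hq hn
    · subst h
      obtain ⟨x, hxl, hx, hn⟩ := ih ((s + 6) :: A) (s + 3)
      have hp : partner ((s + 6) :: A) (s + 3) = (true, (s + 5) :: A) := by
        have := partner_five (s + 6) A
        rwa [show s + 6 + 5 = s + 3 by ring_nf; reduce_mod_char,
          show s + 6 + 7 = s + 5 by ring_nf; reduce_mod_char] at this
      have h1 := (near_first_end hp hx).2
      rw [show s + 3 + 5 = s by ring_nf; reduce_mod_char] at h1
      have h2 : Near 1 (List.replicate x.length s ++ (s + 5) :: A)
          (List.replicate x.length (s + 4) ++ (s + 1) :: A) := by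
        have hq := partner_three (s + 5) A
        rw [show s + 5 + 3 = s by ring_nf; reduce_mod_char,
          show s + 5 + 4 = s + 1 by ring_nf; reduce_mod_char] at hq
        refine .of_partner s ?_
        rw [partner_append_hole (by rw [hq]) (along_replicate _ (.inl rfl)), hq]
        simp
      have h3 := near_opposite_replicate ((s + 1) :: A) x.length (s + 4)
      rw [e44] at h3
      refine ⟨List.replicate x.length s ++ [s + 1], by simp [hxl],
        along_snoc _ _ (along_replicate _ (.inl rfl)) (.inr rfl), ?_⟩
      rw [List.append_assoc]
      refine (((hn.trans h1).trans h2).trans h3).mono ?_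
      rw [hxl, pow_succ, pow_succ]; omega
    · subst h
      obtain ⟨x, hxl, hx, hn⟩ := ih ((s + 7) :: A) (s + 1)
      have hp : partner ((s + 7) :: A) (s + 1) = (true, s :: A) := by
        have := partner_two (s + 7) A
        rwa [show s + 7 + 2 = s + 1 by ring_nf; reduce_mod_char,
          show s + 7 + 1 = s by ring_nf; reduce_mod_char] at this
      have h1 := (near_second_end hp hx).2
      rw [show s + 1 + 4 = s + 5 by ring] at h1
      have h2 := near_opposite_replicate (s :: A) x.length (s + 5)
      rw [show s + 5 + 4 = s + 1 by ring_nf; reduce_mod_char] at h2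
      refine ⟨List.replicate x.length (s + 1) ++ [s], by simp [hxl],
        along_snoc _ _ (along_replicate _ (.inr rfl)) (.inl rfl), ?_⟩
      rw [List.append_assoc]
      refine ((hn.trans h1).trans h2).mono ?_
      rw [hxl, pow_succ, pow_succ]; omega

/-- The diameter of the cell graph is less than `4 * 2 ^ m` (for `m = k + 1`). -/
theorem near_of_length_eq {u v : List (ZMod 8)} (huv : u.length = v.length) (n n' : ZMod 8) :
    Near (7 * 2 ^ u.length - 3) (u ++ [n]) (v ++ [n']) := by
  -- From any subcell of the cell `n` to the outer corners that it shares with its neighbours.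
  have corners : ∀ (w : List (ZMod 8)) (n : ZMod 8),
      Near (3 * 2 ^ w.length - 2) (w ++ [n]) (List.replicate w.length (n + 2) ++ [n]) ∧
      Near (3 * 2 ^ w.length - 2) (w ++ [n]) (List.replicate w.length (n + 6) ++ [n]) := by
    intro w n
    have hpow := Nat.one_le_two_pow (n := w.length)
    constructor
    · obtain ⟨x, hxl, hx, hn⟩ := near_side [n] w (n + 2)
      have h1 := (near_first_end (partner_two n []) hx).1
      rw [hxl] at h1
      exact (hn.trans h1).mono (by rw [pow_succ]; omega)
    · obtain ⟨x, hxl, hx, hn⟩ := near_side [n] w (n + 5)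
      have h1 := (near_second_end (partner_five n []) hx).1
      rw [hxl, show n + 5 + 1 = n + 6 by ring] at h1
      exact (hn.trans h1).mono (by rw [pow_succ]; omega)
  have next : ∀ (k : ℕ) (n : ZMod 8), Near 1 (List.replicate k (n + 2) ++ [n])
      (List.replicate k (n + 1 + 6) ++ [n + 1]) := by
    intro k n
    have hq := partner_two n []
    refine .of_partner (n + 2) ?_
    rw [partner_append_planar (by rw [hq]) (along_replicate _ (.inl rfl)), hq]
    simp; ring_nf; simp
  have anti : ∀ (k : ℕ) (n : ZMod 8), Near 1 (List.replicate k (n + 2) ++ [n])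
      (List.replicate k (n + 4 + 2) ++ [n + 4]) := by
    intro k n
    have hq := partner_one n []
    refine .of_partner (n + 1) ?_
    rw [partner_append_hole (by rw [hq]) (along_replicate _ (.inr (by ring))), hq]
    simp; ring_nf; simp
  -- By symmetry, it is enough to go up to four steps clockwise from the first cell to the second.
  have key : ∀ (u v : List (ZMod 8)) (n d : ZMod 8), u.length = v.length →
      (d = 0 ∨ d = 1 ∨ d = 2 ∨ d = 4 ∨ d = 5) →
      Near (7 * 2 ^ u.length - 3) (u ++ [n]) (v ++ [n + d]) := by
    intro u v n d huv hd
    have hpow := Nat.one_le_two_pow (n := u.length)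
    have hu := (corners u n).1
    rcases hd with rfl | rfl | rfl | rfl | rfl
    · have hv := (corners v n).1.symm
      rw [← huv] at hv
      rw [add_zero]
      exact (hu.trans hv).mono (by omega)
    · have hv := (corners v (n + 1)).2.symm
      rw [← huv] at hv
      exact ((hu.trans (next _ n)).trans hv).mono (by omega)
    · have hv := (corners v (n + 2)).2.symm
      rw [← huv] at hv
      have h1 := near_opposite_replicate [n + 1] u.length (n + 1 + 6)
      rw [show n + 1 + 6 + 4 = n + 1 + 2 by ring_nf; reduce_mod_char] at h1
      have h2 := next u.length (n + 1)
      rw [show n + 1 + 1 = n + 2 by ring] at h2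
      exact ((((hu.trans (next _ n)).trans h1).trans h2).trans hv).mono (by omega)
    · have hv := (corners v (n + 4)).1.symm
      rw [← huv] at hv
      exact ((hu.trans (anti _ n)).trans hv).mono (by omega)
    · have hv := (corners v (n + 5)).2.symm
      rw [← huv] at hv
      have h2 := next u.length (n + 4)
      rw [show n + 4 + 1 = n + 5 by ring] at h2
      exact (((hu.trans (anti _ n)).trans h2).trans hv).mono (by omega)
  rcases side_cases n n' with rfl | rfl | rfl | rfl | rfl | rfl | rfl | rfl
  · simpa using key u v n' 0 huv (by simp)
  · exact key u v n 1 huv (by simp)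
  · exact key u v n 2 huv (by simp)
  · have := (key v u (n + 3) 5 huv.symm (by simp)).symm
    rwa [show n + 3 + 5 = n by ring_nf; reduce_mod_char, ← huv] at this
  · exact key u v n 4 huv (by simp)
  · exact key u v n 5 huv (by simp)
  · have := (key v u (n + 6) 2 huv.symm (by simp)).symm
    rwa [show n + 6 + 2 = n by ring_nf; reduce_mod_char, ← huv] at this
  · have := (key v u (n + 7) 1 huv.symm (by simp)).symm
    rwa [show n + 7 + 1 = n by ring_nf; reduce_mod_char, ← huv] at this

/-! ### Refining a path -/

/-- The distance of the children `a` and `b` of one cell, when only the links inside that cell are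
used. -/
def childDist (a b : ZMod 8) : ℕ :=
  if b - a = 0 then 0 else if b - a = 1 ∨ b - a = 4 ∨ b - a = 7 then 1 else 2

theorem near_childDist (P : List (ZMod 8)) (a b : ZMod 8) :
    Near (childDist a b) (a :: P) (b :: P) := by
  obtain ⟨d, rfl⟩ : ∃ d, b = a + d := ⟨b - a, by ring⟩
  have two : ∀ d d' : ZMod 8, (d = 1 ∨ d = 4 ∨ d = 7) → (d' = 1 ∨ d' = 4 ∨ d' = 7) →
      Near 2 (a :: P) ((a + (d + d')) :: P) := by
    intro d d' hd hd'
    rw [← add_assoc]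
    exact (near_child P a d hd).trans (near_child P (a + d) d' hd')
  unfold childDist
  rw [add_sub_cancel_left]
  split_ifs with h h
  · subst h; rw [add_zero]; exact .refl _ _
  · exact near_child P a d h
  · have hd : d = 1 + 1 ∨ d = 4 + 7 ∨ d = 4 + 1 ∨ d = 7 + 7 := by
      revert d; decide
    rcases hd with rfl | rfl | rfl | rfl <;> exact two _ _ (by simp) (by simp)

theorem childDist_le_two (a b : ZMod 8) : childDist a b ≤ 2 := by
  unfold childDist; split_ifs <;> omega

/-- The ways in which two adjacent cells are joined, seen from one of them, with last letter `n`: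
* `inner`: along the central hole of its parent;
* `hole₀`, `hole₁`: along side `n`, respectively `n - 1`, of the parent, if that side lies on a
  hole;
* `notch₀`, `notch₁`: along the part in a notch of side `n`, respectively `n - 1`, of the parent, if
  that side is common to two cells;
* `flat₀`, `flat₁`: along the other part of such a side;
* `next`, `prev`: along the common side with the following or the preceding child of the parent.

The last constructor `start` is not a way to join cells: it stands for the state at the beginning of
a path. -/
inductive Junction
  | inner | hole₀ | hole₁ | notch₀ | notch₁ | flat₀ | flat₁ | next | prev | start
  deriving DecidableEq

namespace Junction

/-- The same junction, seen from the other cell. -/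
def rev : Junction → Junction
  | flat₀ => flat₁
  | flat₁ => flat₀
  | next => prev
  | prev => next
  | k => k

/-- The children that lie on the junction, relative to the last letter of the cell. -/
def positions : Junction → List (ZMod 8)
  | inner => [3, 4, 5]
  | hole₀ => [0, 1, 2]
  | hole₁ => [6, 7, 0]
  | notch₀ => [1, 2]
  | notch₁ => [6, 7]
  | flat₀ => [0, 1]
  | flat₁ => [7, 0]
  | next => [2, 3]
  | prev => [5, 6]
  | start => [0, 1, 2, 3, 4, 5, 6, 7]

/-- Along a common side of two cells, each of the two children on one side is linked to each of the
two on the other. In all other cases a child is linked to the one in the same relative position. -/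
def complete : Junction → Bool
  | flat₀ | flat₁ | next | prev => true
  | _ => false

/-- Whether a junction of this kind needs side `n` of the parent to be common to two cells. -/
def side₀ : Junction → Bool
  | notch₀ | flat₀ => true
  | _ => false

/-- Whether a junction of this kind needs side `n - 1` of the parent to be common to two cells. -/
def side₁ : Junction → Bool
  | notch₁ | flat₁ => true
  | _ => false

/-- Whether the cell can have a junction of the given kind. -/
def Occurs (k : Junction) (n : ZMod 8) (P : List (ZMod 8)) : Prop :=
  (k.side₀ = true → (partner P n).1 = true) ∧ (k.side₁ = true → (partner P (n + 7)).1 = true)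

/-- The entries of the next cell that can be reached over the junction `k` with at most one step in
the present cell, when the present cell has been entered at one of the positions in `S`. -/
def reach (S : List (ZMod 8)) (k : Junction) : List (ZMod 8) :=
  k.rev.positions.filter fun b => S.any fun p => k.positions.any fun a =>
    (k.complete || a == b) && Nat.ble (childDist p a) 1

/-- Four times the number of delays so far is at most the number of steps so far plus the
potential. A delay is a cell in which two steps are necessary. -/
def potential (k : Junction) (S : List (ZMod 8)) : ℕ :=
  match k with
  | flat₀ | flat₁ | next | prev => 3
  | notch₀ | notch₁ => 2 * S.length - 1
  | inner | hole₀ | hole₁ => if S.length = 1 then 0 else 2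
  | start => 0

/-- The possible sets of positions of minimal cost at the entry of a cell. -/
def states (k : Junction) : List (List (ZMod 8)) :=
  if k = start then k.positions.map fun p => [p]
  else if k.complete then [k.positions]
  else k.positions.sublists.filter (· ≠ [])

/-- The potential pays for the delays. A junction on side `n` of the parent and one on side `n - 1`
cannot both be of the kinds that need a common side, by `not_planar_consecutive`. -/
theorem potential_step (a k : Junction) : k ≠ start →
    ¬ (a.side₀ = true ∧ k.side₁ = true) → ¬ (a.side₁ = true ∧ k.side₀ = true) →
    ∀ S ∈ a.states, if reach S k = [] then a.potential S + 3 ≤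
        k.rev.potential k.rev.positions ∧ k.rev.positions ∈ k.rev.states
      else a.potential S ≤ k.rev.potential (reach S k) + 1 ∧ reach S k ∈ k.rev.states := by
  cases a <;> cases k <;> decide

theorem potential_le (a : Junction) : ∀ S ∈ a.states, a.potential S ≤ 3 := by
  cases a <;> decide

theorem states_ne_nil (a : Junction) : ∀ S ∈ a.states, S ≠ [] := by
  cases a <;> decide

theorem exists_position (k : Junction) : k ≠ start → ∀ b ∈ k.rev.positions, ∃ a ∈ k.positions,
    k.complete = true ∨ a = b := by
  cases k <;> decide

end Junction

/-- The children along a side that is glued across a hole. -/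
theorem near_of_partner_hole {u v : List (ZMod 8)} {i : ZMod 8} (h : partner u i = (false, v))
    {a : ZMod 8} (ha : a = i ∨ a = i + 1) : Near 1 (a :: u) ((a + 4) :: v) := by
  obtain ⟨h1, -, -, h4⟩ := partner_refine_hole (P := u) (i := i) (by rw [h])
  rw [h] at h1 h4
  rcases ha with rfl | rfl
  · exact .of_partner a (by rw [h1])
  · exact .of_partner i (by rw [h4, add_assoc]; norm_num)

/-- The children along a common side of two cells. -/
theorem near_of_partner_planar {u v : List (ZMod 8)} {i : ZMod 8} (h : partner u i = (true, v))
    {a b : ZMod 8} (ha : a = i ∨ a = i + 1) (hb : b = i + 4 ∨ b = i + 5) :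
    Near 1 (a :: u) (b :: v) := by
  obtain ⟨h1, h2, h3, h4⟩ := partner_refine_planar (P := u) (i := i) (by rw [h])
  rw [h] at h1 h2 h3 h4
  rcases ha with rfl | rfl <;> rcases hb with rfl | rfl
  · exact .of_partner (a + 1) (by rw [h2])
  · exact .of_partner a (by rw [h1])
  · exact .of_partner i (by rw [h4])
  · exact .of_partner (i + 7) (by rw [h3])

namespace Junction

/-- The children of two adjacent cells along a junction of kind `k` are linked as described by
`positions` and `complete`. -/
def Joins (k : Junction) (n : ZMod 8) (P : List (ZMod 8)) (n' : ZMod 8) (P' : List (ZMod 8)) :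
    Prop :=
  k ≠ start ∧ k.Occurs n P ∧ k.rev.Occurs n' P' ∧
    ∀ a ∈ k.positions, ∀ b ∈ k.rev.positions, (k.complete = true ∨ a = b) →
      Near 1 ((n + a) :: n :: P) ((n' + b) :: n' :: P')

/-- Every link between two cells belongs to a junction. -/
theorem exists_joins (n : ZMod 8) (P : List (ZMod 8)) (i : ZMod 8) :
    ∃ k : Junction, ∃ n' P', (partner (n :: P) i).2 = n' :: P' ∧ k.Joins n P n' P' := by
  -- A junction across a hole, which consists of the sides `n + s` and `n + t` of the cell.
  have hole : ∀ (k : Junction) (s t : ZMod 8) (P' : List (ZMod 8)), k ≠ start →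
      k.complete = false → (∀ a ∈ k.positions, (a = s ∨ a = s + 1) ∨ (a = t ∨ a = t + 1)) →
      partner (n :: P) (n + s) = (false, (n + 4) :: P') →
      partner (n :: P) (n + t) = (false, (n + 4) :: P') →
      k.Occurs n P → k.rev.Occurs (n + 4) P' → k.Joins n P (n + 4) P' := by
    intro k s t P' hk hc ha hs ht hO hO'
    refine ⟨hk, hO, hO', fun a hak b _ hab => ?_⟩
    obtain rfl : a = b := by simpa [hc] using hab
    rw [show n + 4 + a = n + a + 4 by ring]
    rcases ha a hak with h | h
    · exact near_of_partner_hole hs (by simpa [add_assoc] using h)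
    · exact near_of_partner_hole ht (by simpa [add_assoc] using h)
  -- A junction along the common side `n + s`.
  have planar : ∀ (k : Junction) (s d : ZMod 8) (P' : List (ZMod 8)), k ≠ start →
      (∀ a ∈ k.positions, a = s ∨ a = s + 1) →
      (∀ b ∈ k.rev.positions, d + b = s + 4 ∨ d + b = s + 5) →
      partner (n :: P) (n + s) = (true, (n + d) :: P') →
      k.Occurs n P → k.rev.Occurs (n + d) P' → k.Joins n P (n + d) P' := by
    intro k s d P' hk ha hb h hO hO'
    refine ⟨hk, hO, hO', fun a hak b hbk _ => ?_⟩
    exact near_of_partner_planar h (by simpa [add_assoc] using ha a hak)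
      (by simpa [add_assoc] using hb b hbk)
  have free : ∀ (k : Junction) (n : ZMod 8) (P : List (ZMod 8)), k.side₀ = false →
      k.side₁ = false → k.Occurs n P := by
    intro k n P h₀ h₁
    simp [Occurs, h₀, h₁]
  have sym₀ := partner_symm P n
  have sym₁ := partner_symm P (n + 7)
  have e₀ : n + 5 + 7 = n + 4 := by ring_nf; reduce_mod_char
  have e₁ : n + 7 + 4 = n + 3 := by ring_nf; reduce_mod_char
  have e₂ : n + 4 + 7 = n + 3 := by ring_nf; reduce_mod_char
  have h₀ := partner_zero n P
  have h₁ := partner_one n P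
  have h₆ := partner_six n P
  have h₇ := partner_seven n P
  rcases side_cases n i with rfl | rfl | rfl | rfl | rfl | rfl | rfl | rfl
  · cases h : (partner P i).1
    · have h₀' : partner (i :: P) (i + 0) = (false, (i + 4) :: (partner P i).2) := by
        rw [add_zero, h₀]; simp [h]
      exact ⟨hole₀, i + 4, _, by rw [h₀]; simp [h], hole hole₀ 0 1 _ (by decide) rfl (by decide)
        h₀' h₁ (free _ _ _ rfl rfl) (free _ _ _ rfl rfl)⟩
    · have h₀' : partner (i :: P) (i + 0) = (true, (i + 5) :: (partner P i).2) := by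
        rw [add_zero, h₀]; simp [h]
      exact ⟨flat₀, i + 5, _, by rw [h₀]; simp [h], planar flat₀ 0 5 _ (by decide) (by decide)
        (by decide) h₀' ⟨fun _ => h, by simp [side₁]⟩
        ⟨by simp [side₀, rev], fun _ => by rw [e₀, sym₀, h]⟩⟩
  · cases h : (partner P n).1
    · have h₀' : partner (n :: P) (n + 0) = (false, (n + 4) :: (partner P n).2) := by
        rw [add_zero, h₀]; simp [h]
      exact ⟨hole₀, n + 4, _, by rw [h₁], hole hole₀ 0 1 _ (by decide) rfl (by decide)
        h₀' h₁ (free _ _ _ rfl rfl) (free _ _ _ rfl rfl)⟩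
    · exact ⟨notch₀, n + 4, _, by rw [h₁], hole notch₀ 1 1 _ (by decide) rfl (by decide)
        h₁ h₁ ⟨fun _ => h, by simp [side₁]⟩
        ⟨fun _ => by rw [sym₀, h], by simp [side₁, rev]⟩⟩
  · exact ⟨next, n + 1, P, by rw [partner_two], planar next 2 1 _ (by decide) (by decide)
      (by decide) (partner_two n P) (free _ _ _ rfl rfl) (free _ _ _ rfl rfl)⟩
  · exact ⟨inner, n + 4, P, by rw [partner_three], hole inner 3 4 _ (by decide) rfl (by decide)
      (partner_three n P) (partner_four n P) (free _ _ _ rfl rfl) (free _ _ _ rfl rfl)⟩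
  · exact ⟨inner, n + 4, P, by rw [partner_four], hole inner 3 4 _ (by decide) rfl (by decide)
      (partner_three n P) (partner_four n P) (free _ _ _ rfl rfl) (free _ _ _ rfl rfl)⟩
  · exact ⟨prev, n + 7, P, by rw [partner_five], planar prev 5 7 _ (by decide) (by decide)
      (by decide) (partner_five n P) (free _ _ _ rfl rfl) (free _ _ _ rfl rfl)⟩
  · cases h : (partner P (n + 7)).1
    · rw [h] at h₇
      exact ⟨hole₁, n + 4, _, by rw [h₆], hole hole₁ 6 7 _ (by decide) rfl (by decide)
        h₆ h₇ (free _ _ _ rfl rfl) (free _ _ _ rfl rfl)⟩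
    · exact ⟨notch₁, n + 4, _, by rw [h₆], hole notch₁ 6 6 _ (by decide) rfl (by decide)
        h₆ h₆ ⟨by simp [side₀], fun _ => h⟩
        ⟨by simp [side₀, rev], fun _ => by rw [e₂, ← e₁, sym₁, h]⟩⟩
  · cases h : (partner P (n + 7)).1
    · rw [h] at h₇
      exact ⟨hole₁, n + 4, _, by rw [h₇]; rfl, hole hole₁ 6 7 _ (by decide) rfl (by decide)
        h₆ h₇ (free _ _ _ rfl rfl) (free _ _ _ rfl rfl)⟩
    · rw [h] at h₇
      exact ⟨flat₁, n + 3, _, by rw [h₇]; rfl, planar flat₁ 7 3 _ (by decide) (by decide)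
        (by decide) h₇ ⟨by simp [side₀], fun _ => h⟩
        ⟨fun _ => by rw [← e₁, sym₁, h], by simp [side₁, rev]⟩⟩

end Junction

section

open Junction

/-- Refinement of a path: a chain of `t` links between two cells lifts to a chain between children
of these cells, where almost always two links are enough for each link of the given chain. The set
`S` consists of the positions of the last cell that can be reached at the lowest cost. -/
theorem near_refine {k : ℕ} {u v : List (ZMod 8)} (h : Near k u v) :
    ∀ (n₀ : ZMod 8) (P₀ : List (ZMod 8)) (n : ZMod 8) (P : List (ZMod 8)), v = n₀ :: P₀ →
      u = n :: P → ∀ s : ZMod 8,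
      ∃ t ≤ k, ∃ (a : Junction) (S : List (ZMod 8)) (delay : ℕ), S ∈ a.states ∧ a.Occurs n P ∧
        4 * delay ≤ t + a.potential S ∧
        ∀ p ∈ S, Near (2 * t + delay) (s :: v) ((n + p) :: n :: P) := by
  induction h with
  | refl k u =>
    rintro n₀ P₀ n P rfl h s
    cases h
    refine ⟨0, by omega, start, [s - n₀], 0, ?_, by simp [Occurs, side₀, side₁], by simp, ?_⟩
    · generalize s - n₀ = p; revert p; decide
    · rw [List.forall_mem_singleton, add_sub_cancel]
      exact .refl _ _
  | @head k u v w hl hn ih =>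
    rintro n₀ P₀ n P rfl rfl s
    obtain ⟨i, hi⟩ := hl.symm
    obtain ⟨n₁, P₁, rfl⟩ : ∃ n₁ P₁, v = n₁ :: P₁ := by
      cases v with
      | nil => have := hl.length_eq; simp at this
      | cons n₁ P₁ => exact ⟨_, _, rfl⟩
    obtain ⟨t, htk, a, S, delay, hS, hO, hd, hp⟩ := ih n₀ P₀ n₁ P₁ rfl rfl s
    obtain ⟨k', n', P', h', hk', hO₁, hO₂, hj⟩ := exists_joins n₁ P₁ i
    rw [hi] at h'
    cases h'
    have e : n₁ + 7 + 1 = n₁ := by ring_nf; reduce_mod_char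
    have excl := not_planar_consecutive P₁ (n₁ + 7)
    rw [e] at excl
    have hstep := potential_step a k' hk' (fun h => excl ⟨hO₁.2 h.2, hO.1 h.1⟩)
      (fun h => excl ⟨hO.2 h.1, hO₁.1 h.2⟩) S hS
    split_ifs at hstep with hr
    · refine ⟨t + 1, by omega, k'.rev, k'.rev.positions, delay + 1, hstep.2, hO₂,
        by omega, fun b hb => ?_⟩
      -- A delay: from now on, all entries of the next cell have the same cost.
      obtain ⟨c, hc, hcb⟩ := exists_position k' hk' b hb
      obtain ⟨p, hpS⟩ := List.exists_mem_of_ne_nil S (states_ne_nil a S hS)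
      have h2 := near_childDist (n₁ :: P₁) (n₁ + p) (n₁ + c)
      have := ((hp p hpS).trans h2).trans (hj c hc b hb hcb)
      have := childDist_le_two (n₁ + p) (n₁ + c)
      exact Near.mono ‹_› (by omega)
    · refine ⟨t + 1, by omega, k'.rev, reach S k', delay, hstep.2, hO₂, by omega, fun b hb => ?_⟩
      simp only [reach, List.mem_filter, List.any_eq_true, Bool.and_eq_true, Bool.or_eq_true,
        beq_iff_eq] at hb
      obtain ⟨hb, p, hpS, c, hc, hcb, hpc⟩ := hb
      have h2 := near_childDist (n₁ :: P₁) (n₁ + p) (n₁ + c)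
      have h3 : childDist (n₁ + p) (n₁ + c) = childDist p c := by simp [childDist]
      rw [h3] at h2
      have := ((hp p hpS).trans h2).trans (hj c hc b hb hcb)
      have := Nat.le_of_ble_eq_true hpc
      exact Near.mono ‹_› (by omega)

/-- The distance of children of two cells: two steps for each link, two steps in the last cell, and
the delays. -/
theorem near_child_of_near {k : ℕ} {u v : List (ZMod 8)} (hu : u ≠ []) (h : Near k u v)
    (s t : ZMod 8) : ∃ delay, 4 * delay ≤ k + 3 ∧
      Near (2 * k + 2 + delay) (s :: u) (t :: v) := by
  have hl := h.length_eq
  obtain ⟨n, P, rfl⟩ := List.exists_cons_of_ne_nil hu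
  obtain ⟨n', P', rfl⟩ : ∃ n' P', v = n' :: P' := List.exists_cons_of_ne_nil (by
    rintro rfl; simp at hl)
  obtain ⟨j, hj, a, S, delay, hS, -, hd, hp⟩ := near_refine h.symm _ _ _ _ rfl rfl s
  obtain ⟨p, hpS⟩ := List.exists_mem_of_ne_nil S (states_ne_nil a S hS)
  have h2 := near_childDist (n' :: P') (n' + p) t
  have h3 := childDist_le_two (n' + p) t
  have h4 := potential_le a S hS
  exact ⟨delay, by omega, ((hp p hpS).trans h2).mono (by omega)⟩

end

/-! ### Octagons as intersections of half-planes -/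

/-- The ratio of the contractions. -/
noncomputable def ratio : ℝ := 1 - √2 / 2

local notation "ρ" => ratio

theorem sqrt_two_eq : √2 = 2 - 2 * ρ := by unfold ratio; ring

theorem ratio_sq : 2 * ρ ^ 2 = 4 * ρ - 1 := by
  have := Real.sq_sqrt (show (0 : ℝ) ≤ 2 by norm_num)
  rw [sqrt_two_eq] at this
  linarith

theorem ratio_bounds : 0.29 < ρ ∧ ρ < 0.295 := by
  have h1 : (1.41 : ℝ) < √2 := Real.lt_sqrt_of_sq_lt (by norm_num)
  have h2 : √2 < (1.42 : ℝ) := by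
    rw [Real.sqrt_lt' (by norm_num)]; norm_num
  unfold ratio
  constructor <;> linarith

theorem ratio_pos : 0 < ρ := by linarith [ratio_bounds.1]

theorem one_div_two_add_sqrt_two : 1 / (2 + √2) = ρ := by
  rw [sqrt_two_eq, div_eq_iff (by linarith [ratio_bounds.2])]
  linarith [ratio_sq]

theorem ratio_mul_one_add_sqrt_two : ρ * (1 + √2) = 1 - ρ := by
  rw [sqrt_two_eq]; linarith [ratio_sq]

theorem exp_pow_val_add {w : ℂ} (hw : w ^ 8 = 1) (n k : ZMod 8) :
    w ^ (n + k).val = w ^ n.val * w ^ k.val := by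
  rw [ZMod.val_add, ← pow_eq_pow_mod _ hw, pow_add]

/-- An eighth of a full turn. -/
noncomputable def turn : ℂ := ⟨√2 / 2, √2 / 2⟩

theorem turn_sq : turn ^ 2 = Complex.I := by
  have h : √2 * √2 = 2 := Real.mul_self_sqrt (by norm_num)
  apply Complex.ext <;> simp [turn, pow_two, Complex.mul_re, Complex.mul_im]
  nlinarith

theorem turn_eq : turn = Complex.exp ((Real.pi / 4 : ℝ) * Complex.I) := by
  rw [Complex.exp_mul_I, ← Complex.ofReal_cos, ← Complex.ofReal_sin, Real.cos_pi_div_four,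
    Real.sin_pi_div_four]
  apply Complex.ext <;> simp [turn]

theorem turn_pow_eight : turn ^ 8 = 1 := by
  rw [show turn ^ 8 = (turn ^ 2) ^ 4 by ring, turn_sq, Complex.I_pow_four]

theorem turn_ne_zero : turn ≠ 0 := by
  intro h; have := turn_pow_eight; simp [h] at this

theorem turn_inv_pow_eight : turn⁻¹ ^ 8 = 1 := by rw [inv_pow, turn_pow_eight, inv_one]

theorem turn_add_inv : turn + turn⁻¹ = ((2 - 2 * ρ : ℝ) : ℂ) := by
  have h : turn⁻¹ = ⟨√2 / 2, -(√2 / 2)⟩ := by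
    refine inv_eq_of_mul_eq_one_right ?_
    have h : √2 * √2 = 2 := Real.mul_self_sqrt (by norm_num)
    apply Complex.ext <;> simp [turn, Complex.mul_re, Complex.mul_im]
    nlinarith
  rw [h, ← sqrt_two_eq]
  apply Complex.ext <;> simp [turn]

theorem corner_eq (n : ZMod 8) :
    corner n = Complex.exp ((5 * Real.pi / 8 : ℝ) * Complex.I) * turn⁻¹ ^ n.val := by
  rw [corner, turn_eq, ← Complex.exp_neg, ← Complex.exp_nat_mul, ← Complex.exp_add]
  congr 1
  push_cast
  ring

theorem corner_add (n k : ZMod 8) : corner (n + k) = corner n * turn⁻¹ ^ k.val := by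
  rw [corner_eq, corner_eq, exp_pow_val_add turn_inv_pow_eight, mul_assoc]

/-- The linear function whose value is `1` on side `j` of the basic octagon: the distance from the
origin in the direction of that side, divided by the distance of the side. -/
noncomputable def height (j : ZMod 8) : ℂ →L[ℝ] ℝ :=
  (Real.cos (Real.pi / 8))⁻¹ •
    ((turn ^ j.val).im • Complex.reCLM + (turn ^ j.val).re • Complex.imCLM)

theorem height_apply (j : ZMod 8) (z : ℂ) :
    height j z = (Real.cos (Real.pi / 8))⁻¹ * (z * turn ^ j.val).im := by
  simp [height, Complex.mul_im]; ring

theorem cos_pi_div_eight_pos : 0 < Real.cos (Real.pi / 8) :=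
  Real.cos_pos_of_mem_Ioo ⟨by linarith [Real.pi_pos], by linarith [Real.pi_pos]⟩

theorem height_add_two (j : ZMod 8) (z : ℂ) :
    height (j + 2) z = (2 - 2 * ρ) * height (j + 1) z - height j z := by
  simp only [height_apply, exp_pow_val_add turn_pow_eight]
  have h2 : turn ^ (2 : ZMod 8).val = turn * ((2 - 2 * ρ : ℝ) : ℂ) - 1 := by
    rw [← turn_add_inv, mul_add, mul_inv_cancel₀ turn_ne_zero, show (2 : ZMod 8).val = 2 from rfl]
    ring
  have h1 : turn ^ (1 : ZMod 8).val = turn := by rw [show (1 : ZMod 8).val = 1 from rfl, pow_one]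
  rw [h1, h2, show z * (turn ^ j.val * (turn * ((2 - 2 * ρ : ℝ) : ℂ) - 1)) =
    z * (turn ^ j.val * turn) * ((2 - 2 * ρ : ℝ) : ℂ) - z * turn ^ j.val by ring,
    Complex.sub_im, Complex.im_mul_ofReal]
  ring

theorem corner_add_two (n : ZMod 8) :
    corner (n + 2) = ((2 - 2 * ρ : ℝ) : ℂ) * corner (n + 1) - corner n := by
  rw [corner_add, corner_add]
  have h2 : turn⁻¹ ^ (2 : ZMod 8).val = turn⁻¹ * ((2 - 2 * ρ : ℝ) : ℂ) - 1 := by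
    rw [← turn_add_inv, mul_add, inv_mul_cancel₀ turn_ne_zero, show (2 : ZMod 8).val = 2 from rfl]
    ring
  rw [h2, show (1 : ZMod 8).val = 1 from rfl, pow_one]
  ring

theorem height_corner_add (n k : ZMod 8) : height n (corner (n + k)) = height 0 (corner k) := by
  rw [add_comm, height_apply, height_apply, corner_add, mul_assoc, ← mul_pow,
    inv_mul_cancel₀ turn_ne_zero, one_pow]
  simp

theorem height_self (n : ZMod 8) : height n (corner n) = 1 := by
  have h := height_corner_add n 0
  rw [add_zero] at h
  rw [h, height_apply, corner]
  simp only [ZMod.val_zero, pow_zero, mul_one, Complex.exp_ofReal_mul_I_im]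
  rw [inv_mul_eq_one₀ cos_pi_div_eight_pos.ne', ← Real.sin_add_pi_div_two]
  congr 1
  push_cast
  ring

theorem height_corner_succ (n : ZMod 8) : height n (corner (n + 1)) = 1 := by
  rw [height_corner_add, height_apply, corner]
  simp only [ZMod.val_zero, pow_zero, mul_one, Complex.exp_ofReal_mul_I_im,
    show (1 : ZMod 8).val = 1 from rfl]
  rw [inv_mul_eq_one₀ cos_pi_div_eight_pos.ne', ← Real.sin_pi_div_two_sub]
  congr 1
  push_cast
  ring

theorem height_add_three (j : ZMod 8) (z : ℂ) :
    height (j + 3) z = height (j + 1) z - (2 - 2 * ρ) * height j z := by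
  have h := height_add_two (j + 1) z
  rw [show j + 1 + 2 = j + 3 by ring, show j + 1 + 1 = j + 2 by ring, height_add_two] at h
  rw [h]
  linear_combination 2 * height (j + 1) z * ratio_sq

theorem height_add_four (j : ZMod 8) (z : ℂ) : height (j + 4) z = - height j z := by
  have h := height_add_two (j + 2) z
  rw [show j + 2 + 2 = j + 4 by ring, show j + 2 + 1 = j + 3 by ring, height_add_two,
    height_add_three] at h
  rw [h]
  linear_combination -2 * height j z * ratio_sq

theorem corner_add_four (n : ZMod 8) : corner (n + 4) = - corner n := by
  rw [corner_add, show (4 : ZMod 8).val = 2 * 2 from rfl, pow_mul, inv_pow, turn_sq]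
  simp [pow_two]

/-- The heights of a corner. -/
theorem height_corner (n : ZMod 8) :
    height n (corner n) = 1 ∧ height (n + 1) (corner n) = 1 - 2 * ρ ∧
    height (n + 2) (corner n) = -(1 - 2 * ρ) ∧ height (n + 3) (corner n) = -1 ∧
    height (n + 4) (corner n) = -1 ∧ height (n + 5) (corner n) = -(1 - 2 * ρ) ∧
    height (n + 6) (corner n) = 1 - 2 * ρ ∧ height (n + 7) (corner n) = 1 := by
  have e : ∀ k : ZMod 8, n + (4 + k) = n + k + 4 := fun k => by ring
  have h0 := height_self n
  have h3 : height (n + 3) (corner n) = -1 := by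
    have h := height_corner_succ (n + 7)
    rw [show n + 7 + 1 = n by ring_nf; reduce_mod_char] at h
    rw [show n + 3 = n + 7 + 4 by ring_nf; reduce_mod_char, height_add_four, h]
  have h1 : height (n + 1) (corner n) = 1 - 2 * ρ := by
    have h := height_add_three n (corner n)
    rw [h3, h0] at h
    linarith
  have h2 : height (n + 2) (corner n) = -(1 - 2 * ρ) := by
    rw [height_add_two, h0, h1]; linarith [ratio_sq]
  refine ⟨h0, h1, h2, h3, ?_, ?_, ?_, ?_⟩
  · rw [height_add_four, h0]
  · rw [show n + 5 = n + 1 + 4 by ring, height_add_four, h1]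
  · rw [show n + 6 = n + 2 + 4 by ring, height_add_four, h2]; ring
  · rw [show n + 7 = n + 3 + 4 by ring, height_add_four, h3]; ring

/-- Two consecutive heights determine a point. -/
theorem eq_of_height_eq {z w : ℂ} (j : ZMod 8) (h0 : height j z = height j w)
    (h1 : height (j + 1) z = height (j + 1) w) : z = w := by
  have key : ∀ k : ℕ, height (j + k) z = height (j + k) w ∧
      height (j + k + 1) z = height (j + k + 1) w := by
    intro k
    induction k with
    | zero => simpa using ⟨h0, h1⟩
    | succ k ih =>
      push_cast
      rw [← add_assoc]
      refine ⟨ih.2, ?_⟩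
      rw [add_assoc (j + k), one_add_one_eq_two, height_add_two, height_add_two, ih.1, ih.2]
  have all : ∀ i, height i z = height i w := by
    intro i
    have := (key (i - j).val).1
    rwa [ZMod.natCast_val, ZMod.cast_id, add_sub_cancel] at this
  have hc := cos_pi_div_eight_pos.ne'
  have him := all 0
  have hre := all 2
  rw [height_apply, height_apply] at him hre
  have him := mul_left_cancel₀ (inv_ne_zero hc) him
  have hre := mul_left_cancel₀ (inv_ne_zero hc) hre
  rw [show (2 : ZMod 8).val = 2 from rfl, turn_sq] at hre
  simp only [ZMod.val_zero, pow_zero, mul_one] at him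
  exact Complex.ext (by simpa using hre) him

/-- A point in the cone spanned by two consecutive corners. -/
theorem eq_add_corner {z : ℂ} (j : ZMod 8) :
    z = ((height j z - height (j + 1) z) / (2 * ρ)) • corner j +
      ((height j z - height (j + 7) z) / (2 * ρ)) • corner (j + 1) := by
  have hρ := ratio_pos
  have h7 : height (j + 7) z = (2 - 2 * ρ) * height j z - height (j + 1) z := by
    rw [show j + 7 = j + 3 + 4 by ring, height_add_four, height_add_three]; ring
  obtain ⟨-, c1, -⟩ := height_corner j
  refine eq_of_height_eq j ?_ ?_
  · rw [map_add, map_smul, map_smul, height_self, height_corner_succ, h7]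
    simp only [smul_eq_mul]
    field_simp
    ring
  · rw [map_add, map_smul, map_smul, height_self, c1, h7]
    simp only [smul_eq_mul]
    field_simp
    ring

theorem height_corner_le_one (n j : ZMod 8) : height j (corner n) ≤ 1 := by
  have hρ := ratio_bounds
  obtain ⟨h0, h1, h2, h3, h4, h5, h6, h7⟩ := height_corner n
  rcases side_cases n j with rfl | rfl | rfl | rfl | rfl | rfl | rfl | rfl <;> linarith

theorem octagon_eq : octagon = {z | ∀ j, height j z ≤ 1} := by
  have hρ := ratio_bounds
  apply Set.Subset.antisymm
  · refine convexHull_min ?_ ?_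
    · rintro _ ⟨n, rfl⟩ j
      exact height_corner_le_one n j
    · rw [Set.ofPred_forall]
      exact convex_iInter fun j => convex_halfSpace_le (height j).isLinear 1
  · intro z hz
    -- The point lies in the cone over the side where the height is maximal.
    obtain ⟨j, hj⟩ := Finite.exists_max fun j => height j z
    have hconv : Convex ℝ octagon := convex_convexHull ℝ _
    have hc : ∀ n, corner n ∈ octagon := fun n => subset_convexHull ℝ _ ⟨n, rfl⟩
    have h0 : (0 : ℂ) ∈ octagon := by
      have := hconv (hc 0) (hc 4) (by norm_num : (0 : ℝ) ≤ 1 / 2) (by norm_num : (0 : ℝ) ≤ 1 / 2)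
        (by norm_num)
      have e := corner_add_four 0
      rw [zero_add] at e
      rwa [e, smul_neg, add_neg_cancel] at this
    have h7 : height (j + 7) z = (2 - 2 * ρ) * height j z - height (j + 1) z := by
      rw [show j + 7 = j + 3 + 4 by ring, height_add_four, height_add_three]; ring
    have e1 : 0 ≤ (height j z - height (j + 1) z) / (2 * ρ) :=
      div_nonneg (sub_nonneg.2 (hj _)) (by linarith)
    have e2 : 0 ≤ (height j z - height (j + 7) z) / (2 * ρ) :=
      div_nonneg (sub_nonneg.2 (hj _)) (by linarith)
    have e3 : (height j z - height (j + 1) z) / (2 * ρ) +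
        (height j z - height (j + 7) z) / (2 * ρ) = height j z := by
      have := ratio_pos.ne'
      rw [h7]; field_simp; ring
    rw [eq_add_corner (z := z) j]
    have := hconv.sum_mem (t := Finset.univ) (w := ![(height j z - height (j + 1) z) / (2 * ρ),
      (height j z - height (j + 7) z) / (2 * ρ), 1 - height j z])
      (z := ![corner j, corner (j + 1), 0])
      (by intro i _; fin_cases i <;> simp [e1, e2, hz j]) (by
        simp only [Fin.sum_univ_three, Matrix.cons_val]; linarith)
      (by intro i _; fin_cases i <;> simp [hc, h0])
    simpa [Fin.sum_univ_three] using this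

theorem segment_eq (i : ZMod 8) : segment ℝ (corner i) (corner (i + 1)) =
    {z | height i z = 1 ∧ height (i + 1) z ≤ 1 ∧ height (i + 7) z ≤ 1} := by
  have hρ := ratio_bounds
  have h7 : ∀ z, height (i + 7) z = (2 - 2 * ρ) * height i z - height (i + 1) z := by
    intro z
    rw [show i + 7 = i + 3 + 4 by ring, height_add_four, height_add_three]; ring
  apply Set.Subset.antisymm
  · rintro _ ⟨s, t, hs, ht, hst, rfl⟩
    obtain ⟨-, c1, -⟩ := height_corner i
    simp only [Set.mem_ofPred_eq, h7, map_add, map_smul, height_self, height_corner_succ, c1,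
      smul_eq_mul]
    refine ⟨by linarith, ?_, ?_⟩
    · nlinarith
    · nlinarith
  · rintro z ⟨h0, h1, h2⟩
    refine ⟨_, _, ?_, ?_, ?_, (eq_add_corner i).symm⟩
    · exact div_nonneg (by linarith) (by linarith)
    · exact div_nonneg (by linarith) (by linarith)
    · have := ratio_pos.ne'
      rw [h7, h0]; field_simp; ring

/-! ### The cells in the plane -/

/-- The centre of the octagon of a cell, given by its word from the innermost letter to the
outermost one. -/
noncomputable def centre : List (ZMod 8) → ℂ
  | [] => 0
  | n :: P => centre P + (ρ ^ P.length * (1 - ρ)) • corner n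

/-- The heights over the sides of a cell, scaled such that they are at most `1` in the octagon. -/
noncomputable def cellHeight (u : List (ZMod 8)) (j : ZMod 8) (z : ℂ) : ℝ :=
  height j ((ρ ^ u.length)⁻¹ • (z - centre u))

theorem ratio_pow_pos (m : ℕ) : 0 < ρ ^ m := pow_pos ratio_pos m

@[fun_prop]
theorem continuous_cellHeight (u : List (ZMod 8)) (j : ZMod 8) : Continuous (cellHeight u j) := by
  unfold cellHeight; fun_prop

/-- All heights in terms of two consecutive ones. -/
theorem cellHeight_add (u : List (ZMod 8)) (i : ZMod 8) (z : ℂ) :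
    cellHeight u (i + 2) z = (2 - 2 * ρ) * cellHeight u (i + 1) z - cellHeight u i z ∧
    cellHeight u (i + 3) z = cellHeight u (i + 1) z - (2 - 2 * ρ) * cellHeight u i z ∧
    cellHeight u (i + 4) z = -cellHeight u i z ∧
    cellHeight u (i + 5) z = -cellHeight u (i + 1) z ∧
    cellHeight u (i + 6) z = cellHeight u i z - (2 - 2 * ρ) * cellHeight u (i + 1) z ∧
    cellHeight u (i + 7) z = (2 - 2 * ρ) * cellHeight u i z - cellHeight u (i + 1) z := by
  unfold cellHeight
  refine ⟨height_add_two _ _, height_add_three _ _, height_add_four _ _, ?_, ?_, ?_⟩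
  · rw [show i + 5 = i + 1 + 4 by ring, height_add_four]
  · rw [show i + 6 = i + 2 + 4 by ring, height_add_four, height_add_two]; ring
  · rw [show i + 7 = i + 3 + 4 by ring, height_add_four, height_add_three]; ring

theorem cellHeight_add_four (u : List (ZMod 8)) (i : ZMod 8) (z : ℂ) :
    cellHeight u (i + 4) z = -cellHeight u i z := height_add_four _ _

/-- The heights over a cell in terms of the heights over a child. -/
theorem cellHeight_child (n : ZMod 8) (P : List (ZMod 8)) (z : ℂ) :
    cellHeight P n z = ρ * cellHeight (n :: P) n z + (1 - ρ) ∧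
    cellHeight P (n + 1) z = ρ * cellHeight (n :: P) (n + 1) z + ρ ∧
    cellHeight P (n + 2) z = ρ * cellHeight (n :: P) (n + 2) z - ρ ∧
    cellHeight P (n + 3) z = ρ * cellHeight (n :: P) (n + 3) z - (1 - ρ) ∧
    cellHeight P (n + 4) z = ρ * cellHeight (n :: P) (n + 4) z - (1 - ρ) ∧
    cellHeight P (n + 5) z = ρ * cellHeight (n :: P) (n + 5) z - ρ ∧
    cellHeight P (n + 6) z = ρ * cellHeight (n :: P) (n + 6) z + ρ ∧
    cellHeight P (n + 7) z = ρ * cellHeight (n :: P) (n + 7) z + (1 - ρ) := by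
  have hm := (ratio_pow_pos P.length).ne'
  have hρ := ratio_pos.ne'
  have key : ∀ j, cellHeight P j z = ρ * cellHeight (n :: P) j z +
      (1 - ρ) * height j (corner n) := by
    intro j
    simp only [cellHeight, centre, List.length_cons, map_smul, map_sub, map_add, smul_eq_mul]
    field_simp
    ring
  obtain ⟨h0, h1, h2, h3, h4, h5, h6, h7⟩ := height_corner n
  have hsq := ratio_sq
  refine ⟨?_, ?_, ?_, ?_, ?_, ?_, ?_, ?_⟩
  · rw [key, h0, mul_one]
  · rw [key, h1]; linarith
  · rw [key, h2]; linarith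
  · rw [key, h3]; linarith
  · rw [key, h4]; linarith
  · rw [key, h5]; linarith
  · rw [key, h6]; linarith
  · rw [key, h7]; linarith

theorem cellHeight_sub {u v : List (ZMod 8)} (hl : u.length = v.length) {c : ℂ}
    (h : centre v = centre u + ρ ^ u.length • c) (j : ZMod 8) (z : ℂ) :
    cellHeight v j z = cellHeight u j z - height j c := by
  have hm := (ratio_pow_pos v.length).ne'
  simp only [cellHeight, h, hl, map_smul, map_sub, map_add, smul_eq_mul]
  field_simp
  ring

theorem cellHeight_reflect {u v : List (ZMod 8)} (hl : u.length = v.length) {p : ℂ}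
    (h : centre u + centre v = 2 * p) (j : ZMod 8) (z : ℂ) :
    cellHeight v j (2 * p - z) = cellHeight u (j + 4) z := by
  rw [cellHeight_add_four, cellHeight, cellHeight, ← h, hl, ← map_neg, ← smul_neg]
  congr 2
  ring

/-- The octagon of a cell. -/
def cell (u : List (ZMod 8)) : Set ℂ := {z | ∀ j, cellHeight u j z ≤ 1}

/-- The interior of the octagon of a cell. -/
def openCell (u : List (ZMod 8)) : Set ℂ := {z | ∀ j, cellHeight u j z < 1}

/-- Side `i` of a cell. -/
def side (u : List (ZMod 8)) (i : ZMod 8) : Set ℂ :=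
  {z | cellHeight u i z = 1 ∧ cellHeight u (i + 1) z ≤ 1 ∧ cellHeight u (i + 7) z ≤ 1}

/-- Side `i` of a cell, without its end points. -/
def openSide (u : List (ZMod 8)) (i : ZMod 8) : Set ℂ :=
  {z | cellHeight u i z = 1 ∧ cellHeight u (i + 1) z < 1 ∧ cellHeight u (i + 7) z < 1}

theorem openCell_subset_cell (u : List (ZMod 8)) : openCell u ⊆ cell u := fun _ h j => (h j).le

theorem openSide_subset_side (u : List (ZMod 8)) (i : ZMod 8) : openSide u i ⊆ side u i :=
  fun _ h => ⟨h.1, h.2.1.le, h.2.2.le⟩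

theorem isOpen_openCell (u : List (ZMod 8)) : IsOpen (openCell u) := by
  unfold openCell
  rw [Set.ofPred_forall]
  exact isOpen_iInter_of_finite fun j => isOpen_lt (by fun_prop) continuous_const

/-- A point next to side `i` that is strictly below the two adjacent sides is strictly below all
other sides. -/
theorem cellHeight_lt_one {u : List (ZMod 8)} {i : ZMod 8} {z : ℂ} (h0 : cellHeight u i z ≤ 1)
    (h1 : cellHeight u (i + 1) z < 1) (h7 : cellHeight u (i + 7) z < 1)
    (hi : 1 - 2 * ρ ≤ cellHeight u i z) {j : ZMod 8} (hj : j ≠ i) : cellHeight u j z < 1 := by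
  obtain ⟨e2, e3, e4, e5, e6, e7⟩ := cellHeight_add u i z
  have hρ := ratio_bounds
  have hsq := ratio_sq
  rcases side_cases i j with rfl | rfl | rfl | rfl | rfl | rfl | rfl | rfl
  · exact absurd rfl hj
  · exact h1
  · rw [e2]; nlinarith
  · rw [e3]; nlinarith
  · rw [e4]; nlinarith
  · rw [e5]; nlinarith
  · rw [e6]; nlinarith
  · exact h7

theorem side_subset_cell (u : List (ZMod 8)) (i : ZMod 8) : side u i ⊆ cell u := by
  rintro z ⟨h0, h1, h7⟩ j
  obtain ⟨e2, e3, e4, e5, e6, e7⟩ := cellHeight_add u i z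
  have hρ := ratio_bounds
  have hsq := ratio_sq
  rcases side_cases i j with rfl | rfl | rfl | rfl | rfl | rfl | rfl | rfl
  · exact h0.le
  · exact h1
  · rw [e2]; nlinarith
  · rw [e3]; nlinarith
  · rw [e4]; nlinarith
  · rw [e5]; nlinarith
  · rw [e6]; nlinarith
  · exact h7

theorem cell_cons_subset (n : ZMod 8) (P : List (ZMod 8)) : cell (n :: P) ⊆ cell P := by
  intro z hz j
  obtain ⟨c0, c1, c2, c3, c4, c5, c6, c7⟩ := cellHeight_child n P z
  have hρ := ratio_bounds
  have h := fun j => mul_le_mul_of_nonneg_left (hz j) ratio_pos.le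
  rcases side_cases n j with rfl | rfl | rfl | rfl | rfl | rfl | rfl | rfl
  · linarith [h j]
  · linarith [h (n + 1)]
  · linarith [h (n + 2)]
  · linarith [h (n + 3)]
  · linarith [h (n + 4)]
  · linarith [h (n + 5)]
  · linarith [h (n + 6)]
  · linarith [h (n + 7)]

theorem openCell_cons_subset (n : ZMod 8) (P : List (ZMod 8)) :
    openCell (n :: P) ⊆ openCell P := by
  intro z hz j
  obtain ⟨c0, c1, c2, c3, c4, c5, c6, c7⟩ := cellHeight_child n P z
  have hρ := ratio_bounds
  have h := fun j => mul_lt_mul_of_pos_left (hz j) ratio_pos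
  rcases side_cases n j with rfl | rfl | rfl | rfl | rfl | rfl | rfl | rfl
  · linarith [h j]
  · linarith [h (n + 1)]
  · linarith [h (n + 2)]
  · linarith [h (n + 3)]
  · linarith [h (n + 4)]
  · linarith [h (n + 5)]
  · linarith [h (n + 6)]
  · linarith [h (n + 7)]

theorem neg_one_le_cellHeight {u : List (ZMod 8)} {z : ℂ} (hz : z ∈ cell u) (j : ZMod 8) :
    -1 ≤ cellHeight u j z := by
  have := hz (j + 4)
  rw [cellHeight_add_four] at this
  linarith

theorem isBounded_iUnion_cell : Bornology.IsBounded (⋃ u, cell u) := by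
  have h : ∀ u, cell u ⊆ cell [] := by
    intro u
    induction u with
    | nil => exact subset_rfl
    | cons n P ih => exact (cell_cons_subset n P).trans ih
  have e : cell [] = octagon := by
    rw [octagon_eq]
    simp [cell, cellHeight, centre]
  exact ((isBounded_convexHull.2 (Set.finite_range corner).isBounded).subset e.subset).subset
    (Set.iUnion_subset h)

/-- Any two children of a cell are separated by a line. -/
theorem separate_siblings (n d : ZMod 8) (hd : d = 1 ∨ d = 2 ∨ d = 3 ∨ d = 4)
    (P : List (ZMod 8)) (z : ℂ) :
    (z ∈ cell (n :: P) → cellHeight P (n + 2) z ≤ 0) ∧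
    (z ∈ openCell (n :: P) → cellHeight P (n + 2) z < 0) ∧
    (z ∈ cell ((n + d) :: P) → 0 ≤ cellHeight P (n + 2) z) ∧
    (z ∈ openCell ((n + d) :: P) → 0 < cellHeight P (n + 2) z) := by
  have hρ := ratio_bounds
  obtain ⟨-, -, c2, -⟩ := cellHeight_child n P z
  refine ⟨fun h => by nlinarith [h (n + 2)], fun h => by nlinarith [h (n + 2)], ?_⟩
  have key : ∃ t : ℝ, ρ ≤ t ∧ cellHeight P (n + 2) z =
      ρ * cellHeight ((n + d) :: P) (n + 2) z + t := by
    rcases hd with rfl | rfl | rfl | rfl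
    · refine ⟨ρ, le_rfl, ?_⟩
      have := (cellHeight_child (n + 1) P z).2.1
      rwa [show n + 1 + 1 = n + 2 by ring] at this
    · exact ⟨1 - ρ, by linarith, (cellHeight_child (n + 2) P z).1⟩
    · refine ⟨1 - ρ, by linarith, ?_⟩
      have := (cellHeight_child (n + 3) P z).2.2.2.2.2.2.2
      rwa [show n + 3 + 7 = n + 2 by ring_nf; reduce_mod_char] at this
    · refine ⟨ρ, le_rfl, ?_⟩
      have := (cellHeight_child (n + 4) P z).2.2.2.2.2.2.1
      rwa [show n + 4 + 6 = n + 2 by ring_nf; reduce_mod_char] at this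
  obtain ⟨t, ht, e⟩ := key
  have e4 := cellHeight_add_four ((n + d) :: P) (n + 2) z
  refine ⟨fun h => ?_, fun h => ?_⟩
  · have := h (n + 2 + 4)
    nlinarith
  · have := h (n + 2 + 4)
    nlinarith

/-- The interior of a cell is disjoint from the other cells of the same level. -/
theorem eq_of_mem_openCell {u v : List (ZMod 8)} (hl : u.length = v.length) {z : ℂ}
    (hu : z ∈ openCell u) (hv : z ∈ cell v) : u = v := by
  induction u generalizing v with
  | nil => exact (List.length_eq_zero_iff.1 hl.symm).symm
  | cons n P ih =>
    obtain ⟨n', P', rfl⟩ : ∃ n' P', v = n' :: P' := List.exists_cons_of_ne_nil (by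
      rintro rfl; simp at hl)
    obtain rfl := ih (by simpa using hl) (openCell_cons_subset _ _ hu) (cell_cons_subset _ _ hv)
    congr 1
    have back : ∀ d e : ZMod 8, d + e = 0 → n = n + d + e := by
      intro d e h; rw [add_assoc, h, add_zero]
    rcases side_cases n n' with h | h | h | h | h | h | h | h
    · exact h.symm
    all_goals exfalso; subst h
    · have := separate_siblings n 1 (by simp) P z
      linarith [this.2.1 hu, this.2.2.1 hv]
    · have := separate_siblings n 2 (by simp) P z
      linarith [this.2.1 hu, this.2.2.1 hv]
    · have := separate_siblings n 3 (by simp) P z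
      linarith [this.2.1 hu, this.2.2.1 hv]
    · have := separate_siblings n 4 (by simp) P z
      linarith [this.2.1 hu, this.2.2.1 hv]
    · have := separate_siblings (n + 5) 3 (by simp) P z
      rw [← back 5 3 (by decide)] at this
      linarith [this.1 hv, this.2.2.2 hu]
    · have := separate_siblings (n + 6) 2 (by simp) P z
      rw [← back 6 2 (by decide)] at this
      linarith [this.1 hv, this.2.2.2 hu]
    · have := separate_siblings (n + 7) 1 (by simp) P z
      rw [← back 7 1 (by decide)] at this
      linarith [this.1 hv, this.2.2.2 hu]

theorem mem_closure_of_ray {S : Set ℂ} {z w : ℂ}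
    (h : ∀ t ∈ Set.Ioo (0 : ℝ) 1, z + t • (w - z) ∈ S) : z ∈ closure S := by
  have hcont : Continuous fun t : ℝ => z + t • (w - z) := by fun_prop
  have h0 : z + (0 : ℝ) • (w - z) = z := by simp
  have hlim : Filter.Tendsto (fun t : ℝ => z + t • (w - z)) (nhdsWithin 0 (Set.Ioi 0))
      (nhds z) := by
    have := hcont.tendsto 0
    rw [h0] at this
    exact this.mono_left nhdsWithin_le_nhds
  refine mem_closure_of_tendsto hlim ?_
  filter_upwards [Ioo_mem_nhdsGT (show (0 : ℝ) < 1 by norm_num)] with t ht using h t ht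

/-- Every point of a cell is a limit of interior points. -/
theorem cell_subset_closure_openCell (u : List (ZMod 8)) : cell u ⊆ closure (openCell u) := by
  intro z hz
  refine mem_closure_of_ray (w := centre u) fun t ht j => ?_
  have e : cellHeight u j (z + t • (centre u - z)) = (1 - t) * cellHeight u j z := by
    simp only [cellHeight, map_smul, map_sub, map_add, smul_eq_mul]
    ring
  rw [e]
  have := hz j
  nlinarith [ht.1, ht.2]

/-- The heights of the midpoint of a side. -/
theorem exists_midpoint (u : List (ZMod 8)) (i : ZMod 8) : ∃ z, cellHeight u i z = 1 ∧
    cellHeight u (i + 1) z = 1 - ρ ∧ cellHeight u (i + 7) z = 1 - ρ := by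
  have hm := (ratio_pow_pos u.length).ne'
  have key : ∀ j, cellHeight u j
      (centre u + ρ ^ u.length • ((1 / 2 : ℝ) • (corner i + corner (i + 1)))) =
      (height j (corner i) + height j (corner (i + 1))) / 2 := by
    intro j
    simp only [cellHeight, add_sub_cancel_left, map_smul, map_add, smul_eq_mul]
    field_simp
  refine ⟨centre u + ρ ^ u.length • ((1 / 2 : ℝ) • (corner i + corner (i + 1))), ?_, ?_, ?_⟩
  · rw [key, height_self, height_corner_succ]; norm_num
  · rw [key, height_self, (height_corner i).2.1]; ring
  · have h := (height_corner (i + 1)).2.2.2.2.2.2.1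
    rw [show i + 1 + 6 = i + 7 by ring] at h
    rw [key, h, (height_corner i).2.2.2.2.2.2.2]; ring

theorem openSide_nonempty (u : List (ZMod 8)) (i : ZMod 8) : (openSide u i).Nonempty := by
  obtain ⟨z, h0, h1, h7⟩ := exists_midpoint u i
  have := ratio_pos
  exact ⟨z, h0, by linarith, by linarith⟩

theorem openSide_subset_closure_compl_cell (u : List (ZMod 8)) (i : ZMod 8) :
    openSide u i ⊆ closure (cell u)ᶜ := by
  rintro z ⟨hz, -⟩
  refine mem_closure_of_ray (w := z + (z - centre u)) fun t ht hc => ?_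
  have e : cellHeight u i (z + t • (z + (z - centre u) - z)) = (1 + t) * cellHeight u i z := by
    simp only [cellHeight, map_smul, map_sub, map_add, smul_eq_mul]
    ring
  have := hc i
  rw [e, hz] at this
  linarith [ht.1]

/-- A side is the closure of its relative interior. -/
theorem side_subset_closure_openSide (u : List (ZMod 8)) (i : ZMod 8) :
    side u i ⊆ closure (openSide u i) := by
  intro z hz
  obtain ⟨w, hw⟩ := openSide_nonempty u i
  refine mem_closure_of_ray (w := w) fun t ht => ?_
  have e : ∀ j, cellHeight u j (z + t • (w - z)) =
      (1 - t) * cellHeight u j z + t * cellHeight u j w := by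
    intro j
    simp only [cellHeight, map_smul, map_sub, map_add, smul_eq_mul]
    ring
  obtain ⟨z0, z1, z7⟩ := hz
  obtain ⟨w0, w1, w7⟩ := hw
  refine ⟨?_, ?_, ?_⟩
  · rw [e, z0, w0]; ring
  · rw [e]; nlinarith [ht.1, ht.2]
  · rw [e]; nlinarith [ht.1, ht.2]

/-- The word of a cell as a list, the innermost letter first. -/
def code {m : ℕ} (w : Fin m → ZMod 8) : List (ZMod 8) := (List.ofFn w).reverse

@[simp] theorem length_code {m : ℕ} (w : Fin m → ZMod 8) : (code w).length = m := by simp [code]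

theorem code_injective {m : ℕ} : Function.Injective (code (m := m)) := fun _ _ h =>
  List.ofFn_injective (List.reverse_injective h)

theorem exists_code {m : ℕ} {u : List (ZMod 8)} (h : u.length = m) :
    ∃ w : Fin m → ZMod 8, code w = u := by
  subst h
  refine ⟨fun i => u.reverse.get (i.cast (by simp)), ?_⟩
  unfold code
  rw [List.reverse_eq_iff]
  apply List.ext_get <;> simp

theorem code_succ {m : ℕ} (w : Fin (m + 1) → ZMod 8) : code w = code (Fin.tail w) ++ [w 0] := by
  rw [code, List.ofFn_succ, List.reverse_cons]
  rfl

theorem centre_append (P : List (ZMod 8)) (n : ZMod 8) :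
    centre (P ++ [n]) = (1 - ρ) • corner n + ρ • centre P := by
  induction P with
  | nil => simp [centre]
  | cons k P ih =>
    rw [List.cons_append, centre, ih, centre, List.length_append, List.length_singleton, pow_succ]
    module

theorem contraction_eq (n : ZMod 8) (z : ℂ) : contraction n z = (1 - ρ) • corner n + ρ • z := by
  rw [contraction, one_div_two_add_sqrt_two, ← Complex.real_smul, ← Complex.real_smul, smul_add,
    smul_smul, ratio_mul_one_add_sqrt_two, add_comm]

theorem wordMap_eq {m : ℕ} (w : Fin m → ZMod 8) (z : ℂ) :
    wordMap w z = centre (code w) + ρ ^ m • z := by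
  induction m with
  | zero => simp [wordMap, code, centre]
  | succ m ih =>
    rw [wordMap, Function.comp_apply, ih, contraction_eq, code_succ, centre_append, pow_succ]
    module

theorem wordMap_image {m : ℕ} (w : Fin m → ZMod 8) (S : Set ℂ) :
    wordMap w '' S = {z | (ρ ^ (code w).length)⁻¹ • (z - centre (code w)) ∈ S} := by
  have hm := (ratio_pow_pos m).ne'
  rw [length_code]
  ext z
  constructor
  · rintro ⟨y, hy, rfl⟩
    rw [Set.mem_ofPred_eq, wordMap_eq, add_sub_cancel_left, smul_smul, inv_mul_cancel₀ hm, one_smul]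
    exact hy
  · intro hz
    refine ⟨_, hz, ?_⟩
    rw [wordMap_eq, smul_smul, mul_inv_cancel₀ hm, one_smul, add_sub_cancel]

theorem cellOctagon_eq {m : ℕ} (w : Fin m → ZMod 8) : cellOctagon w = cell (code w) := by
  rw [cellOctagon, wordMap_image, octagon_eq]
  rfl

theorem cellSide_eq {m : ℕ} (w : Fin m → ZMod 8) (i : ZMod 8) :
    cellSide w i = side (code w) i := by
  rw [cellSide, wordMap_image, segment_eq]
  rfl

theorem mem_region {m : ℕ} {z : ℂ} :
    z ∈ region m ↔ ∃ u : List (ZMod 8), u.length = m ∧ z ∈ cell u := by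
  simp only [region, Set.mem_iUnion, cellOctagon_eq]
  constructor
  · rintro ⟨w, hw⟩
    exact ⟨_, length_code w, hw⟩
  · rintro ⟨u, hu, hz⟩
    obtain ⟨w, rfl⟩ := exists_code hu
    exact ⟨w, hz⟩

/-- The centres of two cells with a common side. -/
theorem centre_partner_planar {u : List (ZMod 8)} {i : ZMod 8} (h : (partner u i).1 = true) :
    centre (partner u i).2 = centre u + ρ ^ u.length • (corner i + corner (i + 1)) := by
  induction u generalizing i with
  | nil => simp at h
  | cons n P ih =>
    have hsq := ratio_sq
    have e2 : corner (n + 2) = (2 - 2 * ρ) • corner (n + 1) - corner n := by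
      rw [corner_add_two, Complex.real_smul]
    have e3 : corner (n + 3) = corner (n + 1) - (2 - 2 * ρ) • corner n := by
      have h := corner_add_two (n + 1)
      rw [show n + 1 + 2 = n + 3 by ring, show n + 1 + 1 = n + 2 by ring, ← Complex.real_smul,
        e2] at h
      rw [h]
      match_scalars <;> linarith
    have e5 : corner (n + 5) = -corner (n + 1) := by
      rw [show n + 5 = n + 1 + 4 by ring, corner_add_four]
    have e6 : corner (n + 6) = -corner (n + 2) := by
      rw [show n + 6 = n + 2 + 4 by ring, corner_add_four]
    have e7 : corner (n + 7) = -corner (n + 3) := by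
      rw [show n + 7 = n + 3 + 4 by ring, corner_add_four]
    rcases side_cases n i with rfl | rfl | rfl | rfl | rfl | rfl | rfl | rfl
    · rw [partner_zero] at h ⊢
      split_ifs at h ⊢ with hP
      simp only [centre, length_partner, ih hP, e5, List.length_cons, pow_succ]
      module
    · simp [partner_one] at h
    · rw [partner_two]
      simp only [centre, List.length_cons, pow_succ, show n + 2 + 1 = n + 3 by ring, e3, e2]
      match_scalars
      · ring
      · linear_combination (ρ ^ P.length) * hsq
      · linear_combination -(ρ ^ P.length) * hsq
    · simp [partner_three] at h
    · simp [partner_four] at h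
    · rw [partner_five]
      simp only [centre, List.length_cons, pow_succ, show n + 5 + 1 = n + 6 by ring, e7, e6, e5, e3,
        e2]
      match_scalars
      · ring
      · linear_combination -(ρ ^ P.length) * hsq
      · linear_combination (ρ ^ P.length) * hsq
    · simp [partner_six] at h
    · rw [partner_seven] at h ⊢
      split_ifs at h ⊢ with hP
      have e8 : n + 7 + 1 = n := by ring_nf; reduce_mod_char
      simp only [centre, length_partner, ih hP, e7, e8, List.length_cons, pow_succ]
      module

open Filter Topology

/-! ### Notches -/

/-- The notch in side `i` of a cell: the triangle between its children `i` and `i + 1`. The part of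
the side between these children belongs to it, the sides of the children do not. -/
def notch (u : List (ZMod 8)) (i : ZMod 8) : Set ℂ :=
  {z | cellHeight u i z ≤ 1 ∧ 2 * ρ < cellHeight u (i + 1) z ∧ 2 * ρ < cellHeight u (i + 7) z}

theorem notch_bounds {u : List (ZMod 8)} {i : ZMod 8} {z : ℂ} (hz : z ∈ notch u i) :
    1 - 2 * ρ ≤ cellHeight u i z ∧ cellHeight u (i + 1) z < 2 - 4 * ρ ∧
      cellHeight u (i + 7) z < 2 - 4 * ρ := by
  obtain ⟨h0, h1, h7⟩ := hz
  obtain ⟨-, -, -, -, -, e7⟩ := cellHeight_add u i z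
  have hρ := ratio_bounds
  have hsq := ratio_sq
  refine ⟨?_, ?_, ?_⟩ <;> nlinarith

theorem mem_cell_of_mem_notch {u : List (ZMod 8)} {i : ZMod 8} {z : ℂ} (hz : z ∈ notch u i) :
    z ∈ cell u := by
  obtain ⟨hi, h1, h7⟩ := notch_bounds hz
  have hρ := ratio_bounds
  intro j
  by_cases hj : j = i
  · rw [hj]; exact hz.1
  · exact (cellHeight_lt_one hz.1 (by linarith) (by linarith) hi hj).le

theorem mem_openCell_or_openSide_of_mem_notch {u : List (ZMod 8)} {i : ZMod 8} {z : ℂ}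
    (hz : z ∈ notch u i) : z ∈ openCell u ∨ z ∈ openSide u i := by
  obtain ⟨hi, h1, h7⟩ := notch_bounds hz
  have hρ := ratio_bounds
  rcases hz.1.lt_or_eq with h | h
  · refine .inl fun j => ?_
    by_cases hj : j = i
    · rwa [hj]
    · exact cellHeight_lt_one hz.1 (by linarith) (by linarith) hi hj
  · exact .inr ⟨h, by linarith, by linarith⟩

theorem notMem_child_of_mem_notch {u : List (ZMod 8)} {i : ZMod 8} {z : ℂ} (hz : z ∈ notch u i)
    (n : ZMod 8) : z ∉ cell (n :: u) := by
  intro h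
  obtain ⟨-, h1, h7⟩ := hz
  have hρ := ratio_bounds
  obtain ⟨c0, c1, c2, c3, c4, c5, c6, c7⟩ := cellHeight_child n u z
  have e : ∀ k l : ZMod 8, i + k + l = i + (k + l) := fun k l => add_assoc _ _ _
  have hc := fun j => mul_le_mul_of_nonneg_left (h j) ratio_pos.le
  rcases side_cases i n with rfl | rfl | rfl | rfl | rfl | rfl | rfl | rfl
  · linarith [hc (n + 1)]
  · have := hc (i + 1 + 6)
    rw [e, show (1 : ZMod 8) + 6 = 7 by decide] at this c6
    linarith
  · have := hc (i + 2 + 5)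
    rw [e, show (2 : ZMod 8) + 5 = 7 by decide] at this c5
    linarith
  · have := hc (i + 3 + 4)
    rw [e, show (3 : ZMod 8) + 4 = 7 by decide] at this c4
    linarith
  · have := hc (i + 4 + 3)
    rw [e, show (4 : ZMod 8) + 3 = 7 by decide] at this c3
    linarith
  · have := hc (i + 5 + 4)
    rw [e, show (5 : ZMod 8) + 4 = 1 by decide] at this c4
    linarith
  · have := hc (i + 6 + 3)
    rw [e, show (6 : ZMod 8) + 3 = 1 by decide] at this c3
    linarith
  · have := hc (i + 7 + 2)
    rw [e, show (7 : ZMod 8) + 2 = 1 by decide] at this c2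
    linarith

/-- The heights over side `i` and its neighbours, in terms of the two children along that side. -/
theorem cellHeight_side_children (u : List (ZMod 8)) (i : ZMod 8) (z : ℂ) :
    (cellHeight u i z = ρ * cellHeight (i :: u) i z + (1 - ρ) ∧
    cellHeight u (i + 1) z = ρ * cellHeight (i :: u) (i + 1) z + ρ ∧
    cellHeight u (i + 2) z = ρ * cellHeight (i :: u) (i + 2) z - ρ ∧
    cellHeight u (i + 7) z = ρ * cellHeight (i :: u) (i + 7) z + (1 - ρ)) ∧
    (cellHeight u i z = ρ * cellHeight ((i + 1) :: u) i z + (1 - ρ) ∧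
    cellHeight u (i + 1) z = ρ * cellHeight ((i + 1) :: u) (i + 1) z + (1 - ρ) ∧
    cellHeight u (i + 6) z = ρ * cellHeight ((i + 1) :: u) (i + 6) z - ρ ∧
    cellHeight u (i + 7) z = ρ * cellHeight ((i + 1) :: u) (i + 7) z + ρ) := by
  obtain ⟨c0, c1, c2, -, -, -, -, c7⟩ := cellHeight_child i u z
  obtain ⟨d0, -, -, -, -, d5, d6, d7⟩ := cellHeight_child (i + 1) u z
  rw [show i + 1 + 7 = i by ring_nf; reduce_mod_char] at d7
  rw [show i + 1 + 6 = i + 7 by ring] at d6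
  rw [show i + 1 + 5 = i + 6 by ring] at d5
  exact ⟨⟨c0, c1, c2, c7⟩, d7, d0, d5, d6⟩

/-- The boundary of a notch, except for the base, consists of sides of the two children. -/
theorem mem_closure_notch_cases {u : List (ZMod 8)} {i : ZMod 8} {z : ℂ}
    (h0 : cellHeight u i z ≤ 1) (h1 : 2 * ρ ≤ cellHeight u (i + 1) z)
    (h7 : 2 * ρ ≤ cellHeight u (i + 7) z) :
    z ∈ notch u i ∨ z ∈ side (i :: u) (i + 1) ∨ z ∈ side ((i + 1) :: u) (i + 7) := by
  obtain ⟨⟨c0, c1, c2, c7⟩, d0, d1, d6, d7⟩ := cellHeight_side_children u i z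
  obtain ⟨e2, -, -, -, e6, e7⟩ := cellHeight_add u i z
  have hρ := ratio_bounds
  have hsq := ratio_sq
  rcases h1.lt_or_eq with h1' | h1'
  · rcases h7.lt_or_eq with h7' | h7'
    · exact .inl ⟨h0, h1', h7'⟩
    · refine .inr (.inr ⟨?_, ?_, ?_⟩)
      · nlinarith
      · rw [show i + 7 + 1 = i by ring_nf; reduce_mod_char]; nlinarith
      · rw [show i + 7 + 7 = i + 6 by ring_nf; reduce_mod_char]; nlinarith
  · refine .inr (.inl ⟨?_, ?_, ?_⟩)
    · nlinarith
    · rw [show i + 1 + 1 = i + 2 by ring]; nlinarith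
    · rw [show i + 1 + 7 = i by ring_nf; reduce_mod_char]; nlinarith

/-- A side is covered by its notch and the two children along it. -/
theorem mem_side_cases {u : List (ZMod 8)} {i : ZMod 8} {z : ℂ} (hz : z ∈ side u i) :
    z ∈ notch u i ∨ z ∈ side (i :: u) i ∨ z ∈ side ((i + 1) :: u) i := by
  obtain ⟨⟨c0, c1, c2, c7⟩, d0, d1, d6, d7⟩ := cellHeight_side_children u i z
  obtain ⟨h0, h1, h7⟩ := hz
  have hρ := ratio_bounds
  rcases le_or_gt (cellHeight u (i + 1) z) (2 * ρ) with h | h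
  · exact .inr (.inl ⟨by nlinarith, by nlinarith, by nlinarith⟩)
  · rcases le_or_gt (cellHeight u (i + 7) z) (2 * ρ) with h' | h'
    · exact .inr (.inr ⟨by nlinarith, by nlinarith, by nlinarith⟩)
    · exact .inl ⟨h0.le, h, h'⟩

theorem eventually_lt_of_mem_openSide {u : List (ZMod 8)} {i : ZMod 8} {z : ℂ}
    (hz : z ∈ openSide u i) : ∀ᶠ w in 𝓝 z, ∀ j ≠ i, cellHeight u j w < 1 := by
  have hρ := ratio_bounds
  rw [eventually_all]
  intro j
  by_cases hj : j = i
  · exact .of_forall fun w h => absurd hj h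
  · have := cellHeight_lt_one hz.1.le hz.2.1 hz.2.2 (by rw [hz.1]; linarith) hj
    filter_upwards [(continuous_cellHeight u j).continuousAt.eventually_lt_const this] with w hw _
    exact hw

theorem mem_cell_of_lt {u : List (ZMod 8)} {i : ZMod 8} {w : ℂ}
    (h : ∀ j ≠ i, cellHeight u j w < 1) (hi : cellHeight u i w ≤ 1) : w ∈ cell u := by
  intro j
  by_cases hj : j = i
  · rwa [hj]
  · exact (h j hj).le

/-- The notch fills the outer half of a neighbourhood of every inner point of its two sides. -/
theorem notch_union_cell_mem_nhds {u : List (ZMod 8)} {i : ZMod 8} {z : ℂ} :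
    (z ∈ openSide (i :: u) (i + 1) → notch u i ∪ cell (i :: u) ∈ 𝓝 z) ∧
    (z ∈ openSide ((i + 1) :: u) (i + 7) → notch u i ∪ cell ((i + 1) :: u) ∈ 𝓝 z) := by
  have hρ := ratio_bounds
  have hsq := ratio_sq
  have n1 : i ≠ i + 1 := by
    have : (1 : ZMod 8) ≠ 0 := by decide
    simp [this]
  have n7 : i ≠ i + 7 := by
    have : (7 : ZMod 8) ≠ 0 := by decide
    simp [this]
  constructor
  · intro hz
    obtain ⟨⟨c0, c1, c2, c7⟩, -⟩ := cellHeight_side_children u i z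
    obtain ⟨e2, -, -, -, e6, e7⟩ := cellHeight_add u i z
    obtain ⟨h0, h1, h7⟩ := id hz
    rw [show i + 1 + 1 = i + 2 by ring] at h1
    rw [show i + 1 + 7 = i by ring_nf; reduce_mod_char] at h7
    have hy : cellHeight u (i + 1) z = 2 * ρ := by rw [c1, h0]; ring
    have hx : 2 - 4 * ρ < cellHeight u i z := by rw [hy] at e2; nlinarith
    have key : 2 * ρ < cellHeight u (i + 7) z := by rw [e7, hy]; nlinarith
    filter_upwards [eventually_lt_of_mem_openSide hz,
      (continuous_cellHeight u (i + 7)).continuousAt.eventually_const_lt key] with w hw hw'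
    rcases le_or_gt (cellHeight (i :: u) (i + 1) w) 1 with h | h
    · exact .inr (mem_cell_of_lt hw h)
    · obtain ⟨⟨c0, c1, -⟩, -⟩ := cellHeight_side_children u i w
      exact .inl ⟨by nlinarith [hw i n1], by nlinarith, hw'⟩
  · intro hz
    obtain ⟨-, d0, d1, d6, d7⟩ := cellHeight_side_children u i z
    obtain ⟨e2, -, -, -, e6, e7⟩ := cellHeight_add u i z
    obtain ⟨h0, h1, h7⟩ := id hz
    rw [show i + 7 + 7 = i + 6 by ring_nf; reduce_mod_char] at h7
    rw [show i + 7 + 1 = i by ring_nf; reduce_mod_char] at h1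
    have key : 2 * ρ < cellHeight u (i + 1) z := by nlinarith
    filter_upwards [eventually_lt_of_mem_openSide hz,
      (continuous_cellHeight u (i + 1)).continuousAt.eventually_const_lt key] with w hw hw'
    rcases le_or_gt (cellHeight ((i + 1) :: u) (i + 7) w) 1 with h | h
    · exact .inr (mem_cell_of_lt hw h)
    · obtain ⟨-, d0, -, -, d7⟩ := cellHeight_side_children u i w
      exact .inl ⟨by nlinarith [hw i n7], hw', by nlinarith⟩

theorem openSide_child_subset {u : List (ZMod 8)} {i : ZMod 8} :
    openSide (i :: u) i ⊆ openSide u i ∧ openSide ((i + 1) :: u) i ⊆ openSide u i := by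
  have hρ := ratio_bounds
  constructor
  · rintro z ⟨h0, h1, h7⟩
    obtain ⟨⟨c0, c1, c2, c7⟩, -⟩ := cellHeight_side_children u i z
    exact ⟨by rw [c0, h0]; ring, by nlinarith, by nlinarith⟩
  · rintro z ⟨h0, h1, h7⟩
    obtain ⟨-, d0, d1, d6, d7⟩ := cellHeight_side_children u i z
    exact ⟨by rw [d0, h0]; ring, by nlinarith, by nlinarith⟩

/-- Near an inner point of the outer side of a child, the parent and the child coincide. -/
theorem eventually_mem_child {u : List (ZMod 8)} {i : ZMod 8} {z : ℂ} :
    (z ∈ openSide (i :: u) i → ∀ᶠ w in 𝓝 z, w ∈ cell u → w ∈ cell (i :: u)) ∧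
    (z ∈ openSide ((i + 1) :: u) i → ∀ᶠ w in 𝓝 z, w ∈ cell u → w ∈ cell ((i + 1) :: u)) := by
  have hρ := ratio_bounds
  constructor
  · intro hz
    filter_upwards [eventually_lt_of_mem_openSide hz] with w hw hu
    obtain ⟨⟨c0, -⟩, -⟩ := cellHeight_side_children u i w
    exact mem_cell_of_lt hw (by nlinarith [hu i])
  · intro hz
    filter_upwards [eventually_lt_of_mem_openSide hz] with w hw hu
    obtain ⟨-, d0, -⟩ := cellHeight_side_children u i w
    exact mem_cell_of_lt hw (by nlinarith [hu i])

/-- If near `z` there is nothing but the cell `u` and a set that avoids the interior of `v`, then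
`z` lies in `v` only if `v = u`. -/
theorem eq_of_union_mem_nhds {u v : List (ZMod 8)} (hl : v.length = u.length) {U : Set ℂ} {z : ℂ}
    (hU : U ∪ cell u ∈ 𝓝 z) (hd : ∀ w ∈ U, w ∉ openCell v) (hz : z ∈ cell v) : v = u := by
  obtain ⟨w, hw, hv⟩ := mem_closure_iff_nhds.1 (cell_subset_closure_openCell v hz) _ hU
  rcases hw with hw | hw
  · exact absurd hv (hd w hw)
  · exact eq_of_mem_openCell hl hv hw

theorem notch_reflect {u v : List (ZMod 8)} (hl : u.length = v.length) {p : ℂ}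
    (h : centre u + centre v = 2 * p) {i : ZMod 8} {z : ℂ} (hz : z ∈ notch u i) :
    2 * p - z ∈ notch v (i + 4) := by
  have e : ∀ k : ZMod 8, i + 4 + k + 4 = i + k := by
    intro k; ring_nf; reduce_mod_char
  have := e 0
  simp only [add_zero] at this
  simpa only [notch, Set.mem_ofPred_eq, cellHeight_reflect hl h, e, this] using hz

theorem side_reflect {u v : List (ZMod 8)} (hl : u.length = v.length) {p : ℂ}
    (h : centre u + centre v = 2 * p) {i : ZMod 8} {z : ℂ} (hz : z ∈ side u i) :
    2 * p - z ∈ side v (i + 4) := by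
  have e : ∀ k : ZMod 8, i + 4 + k + 4 = i + k := by
    intro k; ring_nf; reduce_mod_char
  have := e 0
  simp only [add_zero] at this
  simpa only [side, Set.mem_ofPred_eq, cellHeight_reflect hl h, e, this] using hz

theorem openSide_reflect {u v : List (ZMod 8)} (hl : u.length = v.length) {p : ℂ}
    (h : centre u + centre v = 2 * p) {i : ZMod 8} {z : ℂ} (hz : z ∈ openSide u i) :
    2 * p - z ∈ openSide v (i + 4) := by
  have e : ∀ k : ZMod 8, i + 4 + k + 4 = i + k := by
    intro k; ring_nf; reduce_mod_char
  have := e 0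
  simp only [add_zero] at this
  simpa only [openSide, Set.mem_ofPred_eq, cellHeight_reflect hl h, e, this] using hz

theorem cellHeight_combo (u : List (ZMod 8)) (j : ZMod 8) {s t : ℝ} (hst : s + t = 1) (z w : ℂ) :
    cellHeight u j (s • z + t • w) = s * cellHeight u j z + t * cellHeight u j w := by
  simp only [cellHeight, map_smul, map_add, map_sub, smul_eq_mul]
  linear_combination ((ρ ^ u.length)⁻¹ * height j (centre u)) * hst

theorem convex_lt_cellHeight (u : List (ZMod 8)) (j : ZMod 8) (c : ℝ) :
    Convex ℝ {z | c < cellHeight u j z} := by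
  intro z hz w hw s t hs ht hst
  rw [Set.mem_ofPred_eq, cellHeight_combo u j hst]
  exact convex_Ioi c hz hw hs ht hst

theorem convex_cellHeight_lt (u : List (ZMod 8)) (j : ZMod 8) (c : ℝ) :
    Convex ℝ {z | cellHeight u j z < c} := by
  intro z hz w hw s t hs ht hst
  rw [Set.mem_ofPred_eq, cellHeight_combo u j hst]
  exact convex_Iio c hz hw hs ht hst

theorem convex_cellHeight_le (u : List (ZMod 8)) (j : ZMod 8) (c : ℝ) :
    Convex ℝ {z | cellHeight u j z ≤ c} := by
  intro z hz w hw s t hs ht hst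
  rw [Set.mem_ofPred_eq, cellHeight_combo u j hst]
  exact convex_Iic c hz hw hs ht hst

theorem convex_notch (u : List (ZMod 8)) (i : ZMod 8) : Convex ℝ (notch u i) :=
  (convex_cellHeight_le u i 1).inter ((convex_lt_cellHeight u (i + 1) (2 * ρ)).inter
    (convex_lt_cellHeight u (i + 7) (2 * ρ)))

/-! ### Holes -/

/-- `O` is a component of the complement of the level-`m` approximation, symmetric about `p`, and
`B` is the set of the sides on its boundary, each given by its cell and its number. Instead of the
statement about components, the structure records what makes it work in the recursion on the level:
the boundary of `O` consists of the sides in `B`, and `O` fills the outer half of a neighbourhood of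
every inner point of these sides. -/
structure IsHole (m : ℕ) (O : Set ℂ) (p : ℂ) (B : Set (List (ZMod 8) × ZMod 8)) : Prop where
  isOpen : IsOpen O
  nonempty : O.Nonempty
  isPreconnected : IsPreconnected O
  notMem_cell : ∀ u : List (ZMod 8), u.length = m → ∀ z ∈ O, z ∉ cell u
  closure_cases : ∀ z ∈ closure O, z ∈ O ∨ ∃ b ∈ B, z ∈ side b.1 b.2
  reflect : ∀ z ∈ O, 2 * p - z ∈ O
  union_mem_nhds : ∀ u i, (u, i) ∈ B → ∀ z ∈ openSide u i, O ∪ cell u ∈ 𝓝 z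
  length : ∀ u i, (u, i) ∈ B → u.length = m
  not_planar : ∀ u i, (u, i) ∈ B → (partner u i).1 = false
  partner_mem : ∀ u i, (u, i) ∈ B → ((partner u i).2, i + 4) ∈ B
  centre_add : ∀ u i, (u, i) ∈ B → centre u + centre (partner u i).2 = 2 * p
  isBounded : Bornology.IsBounded O ∨ Bornology.IsBounded Oᶜ

/-- The sides of the children that lie on the hole into which a hole grows in the next level. -/
def refinedSides (B : Set (List (ZMod 8) × ZMod 8)) : Set (List (ZMod 8) × ZMod 8) :=
  {c | ∃ u i, (u, i) ∈ B ∧ (c = (i :: u, i) ∨ c = (i :: u, i + 1) ∨ c = ((i + 1) :: u, i + 7) ∨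
    c = ((i + 1) :: u, i))}

/-- A property of the sides on the grown hole can be checked on the four pieces of each side. -/
theorem refinedSides_induction {B : Set (List (ZMod 8) × ZMod 8)}
    {Q : List (ZMod 8) → ZMod 8 → Prop}
    (h : ∀ u i, (u, i) ∈ B → Q (i :: u) i ∧ Q (i :: u) (i + 1) ∧ Q ((i + 1) :: u) (i + 7) ∧
      Q ((i + 1) :: u) i) : ∀ v j, (v, j) ∈ refinedSides B → Q v j := by
  rintro v j ⟨u, i, hb, h'⟩
  obtain ⟨h1, h2, h3, h4⟩ := h u i hb
  rcases h' with h' | h' | h' | h' <;> cases h' <;> assumption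

theorem IsHole.openSide_subset_closure {m : ℕ} {O : Set ℂ} {p : ℂ}
    {B : Set (List (ZMod 8) × ZMod 8)} (h : IsHole m O p B) {u : List (ZMod 8)} {i : ZMod 8}
    (hb : (u, i) ∈ B) : openSide u i ⊆ closure O := by
  intro z hz
  rw [mem_closure_iff_nhds]
  intro V hV
  obtain ⟨w, ⟨hwV, hw⟩, hwu⟩ := mem_closure_iff_nhds.1 (openSide_subset_closure_compl_cell u i hz) _
    (inter_mem hV (h.union_mem_nhds u i hb z hz))
  exact ⟨w, hwV, hw.resolve_right hwu⟩

theorem IsHole.finite {m : ℕ} {O : Set ℂ} {p : ℂ} {B : Set (List (ZMod 8) × ZMod 8)}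
    (h : IsHole m O p B) : B.Finite :=
  ((List.finite_length_eq (ZMod 8) m).prod Set.finite_univ).subset
    fun b hb => ⟨h.length b.1 b.2 hb, trivial⟩

theorem closure_notch_subset (u : List (ZMod 8)) (i : ZMod 8) : closure (notch u i) ⊆
    {z | cellHeight u i z ≤ 1 ∧ 2 * ρ ≤ cellHeight u (i + 1) z ∧
      2 * ρ ≤ cellHeight u (i + 7) z} :=
  closure_minimal (fun _ hz => ⟨hz.1, hz.2.1.le, hz.2.2.le⟩)
    ((isClosed_le (by fun_prop) continuous_const).and
      ((isClosed_le continuous_const (by fun_prop)).and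
        (isClosed_le continuous_const (by fun_prop))))

/-- In the next level, a hole grows by the notches in the sides on its boundary. -/
theorem IsHole.succ {m : ℕ} {O : Set ℂ} {p : ℂ} {B : Set (List (ZMod 8) × ZMod 8)}
    (h : IsHole m O p B) :
    IsHole (m + 1) (O ∪ ⋃ b ∈ B, notch b.1 b.2) p (refinedSides B) where
  isOpen := by
    rw [isOpen_iff_mem_nhds]
    rintro z (hz | hz)
    · exact mem_of_superset (h.isOpen.mem_nhds hz) Set.subset_union_left
    · simp only [Set.mem_iUnion] at hz
      obtain ⟨⟨u, i⟩, hb, hz⟩ := hz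
      have e1 := (continuous_cellHeight u (i + 1)).continuousAt.eventually_const_lt hz.2.1
      have e7 := (continuous_cellHeight u (i + 7)).continuousAt.eventually_const_lt hz.2.2
      have hU : O ∪ cell u ∈ 𝓝 z := by
        rcases mem_openCell_or_openSide_of_mem_notch hz with h' | h'
        · exact mem_of_superset ((isOpen_openCell u).mem_nhds h')
            ((openCell_subset_cell u).trans Set.subset_union_right)
        · exact h.union_mem_nhds u i hb z h'
      filter_upwards [e1, e7, hU] with w h1 h7 hw
      rcases hw with hw | hw
      · exact .inl hw
      · exact .inr (Set.mem_biUnion hb ⟨hw i, h1, h7⟩)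
  nonempty := h.nonempty.mono Set.subset_union_left
  isPreconnected := by
    obtain ⟨x, hx⟩ := h.nonempty
    have key : ∀ b ∈ B, IsPreconnected (O ∪ notch b.1 b.2) := by
      rintro ⟨u, i⟩ hb
      obtain ⟨z, h0, h1, h7⟩ := exists_midpoint u i
      have hρ := ratio_bounds
      have hz : z ∈ openSide u i := ⟨h0, by linarith, by linarith⟩
      have hz' : z ∈ notch u i := ⟨h0.le, by linarith, by linarith⟩
      have hO : IsPreconnected (insert z O) := h.isPreconnected.subset_closure
        (Set.subset_insert z O)
        (Set.insert_subset (h.openSide_subset_closure hb hz) subset_closure)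
      have := hO.union z (Set.mem_insert z O) hz' (convex_notch u i).isPreconnected
      rwa [Set.insert_union, Set.insert_eq_of_mem (.inr hz')] at this
    rw [show O ∪ ⋃ b ∈ B, notch b.1 b.2 = ⋃₀ (insert O ((fun b => O ∪ notch b.1 b.2) '' B)) by
      ext z
      simp only [Set.mem_union, Set.mem_iUnion, Set.mem_sUnion, Set.mem_insert_iff, Set.mem_image]
      constructor
      · rintro (hz | ⟨b, hb, hz⟩)
        · exact ⟨O, .inl rfl, hz⟩
        · exact ⟨_, .inr ⟨b, hb, rfl⟩, .inr hz⟩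
      · rintro ⟨_, rfl | ⟨b, hb, rfl⟩, hz⟩
        · exact .inl hz
        · exact hz.imp_right fun hz => ⟨b, hb, hz⟩]
    refine isPreconnected_sUnion x _ ?_ ?_
    · rintro _ (rfl | ⟨b, hb, rfl⟩)
      · exact hx
      · exact .inl hx
    · rintro _ (rfl | ⟨b, hb, rfl⟩)
      · exact h.isPreconnected
      · exact key b hb
  notMem_cell := by
    intro v hv z hz hzv
    obtain ⟨n, P, rfl⟩ : ∃ n P, v = n :: P := List.exists_cons_of_ne_nil (by
      rintro rfl; simp at hv)
    have hP : P.length = m := by simpa using hv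
    have hzP := cell_cons_subset n P hzv
    rcases hz with hz | hz
    · exact h.notMem_cell P hP z hz hzP
    · simp only [Set.mem_iUnion] at hz
      obtain ⟨⟨u, i⟩, hb, hz⟩ := hz
      have hl : P.length = u.length := by rw [hP, h.length u i hb]
      have : P = u := by
        rcases mem_openCell_or_openSide_of_mem_notch hz with h' | h'
        · exact (eq_of_mem_openCell hl.symm h' hzP).symm
        · exact eq_of_union_mem_nhds hl (h.union_mem_nhds u i hb z h')
            (fun w hw hw' => h.notMem_cell P hP w hw (openCell_subset_cell P hw')) hzP
      subst this
      exact notMem_child_of_mem_notch hz n hzv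
  closure_cases := by
    intro z hz
    rw [closure_union, h.finite.closure_biUnion] at hz
    have side : ∀ u i, (u, i) ∈ B → z ∈ side (i :: u) i ∨ z ∈ side (i :: u) (i + 1) ∨
        z ∈ side ((i + 1) :: u) (i + 7) ∨ z ∈ side ((i + 1) :: u) i →
        ∃ b ∈ refinedSides B, z ∈ side b.1 b.2 := by
      rintro u i hb (h' | h' | h' | h')
      · exact ⟨(_, _), ⟨u, i, hb, by simp⟩, h'⟩
      · exact ⟨(_, _), ⟨u, i, hb, by simp⟩, h'⟩
      · exact ⟨(_, _), ⟨u, i, hb, by simp⟩, h'⟩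
      · exact ⟨(_, _), ⟨u, i, hb, by simp⟩, h'⟩
    rcases hz with hz | hz
    · rcases h.closure_cases z hz with hz | ⟨⟨u, i⟩, hb, hz⟩
      · exact .inl (.inl hz)
      · rcases mem_side_cases hz with h' | h' | h'
        · exact .inl (.inr (Set.mem_biUnion hb h'))
        · exact .inr (side u i hb (by simp [h']))
        · exact .inr (side u i hb (by simp [h']))
    · simp only [Set.mem_iUnion] at hz
      obtain ⟨⟨u, i⟩, hb, hz⟩ := hz
      obtain ⟨h0, h1, h7⟩ := closure_notch_subset u i hz
      rcases mem_closure_notch_cases h0 h1 h7 with h' | h' | h'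
      · exact .inl (.inr (Set.mem_biUnion hb h'))
      · exact .inr (side u i hb (by simp [h']))
      · exact .inr (side u i hb (by simp [h']))
  reflect := by
    rintro z (hz | hz)
    · exact .inl (h.reflect z hz)
    · simp only [Set.mem_iUnion] at hz
      obtain ⟨⟨u, i⟩, hb, hz⟩ := hz
      exact .inr (Set.mem_biUnion (h.partner_mem u i hb)
        (notch_reflect (length_partner u i).symm (h.centre_add u i hb) hz))
  union_mem_nhds := by
    refine refinedSides_induction fun u i hb => ?_
    have hN : notch u i ⊆ O ∪ ⋃ b ∈ B, notch b.1 b.2 :=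
      (Set.subset_biUnion_of_mem (u := fun b : List (ZMod 8) × ZMod 8 => notch b.1 b.2)
        hb).trans Set.subset_union_right
    refine ⟨fun z hz => ?_, fun z hz => ?_, fun z hz => ?_, fun z hz => ?_⟩
    · filter_upwards [eventually_mem_child.1 hz,
        h.union_mem_nhds u i hb z (openSide_child_subset.1 hz)] with w hw hw'
      exact hw'.imp .inl hw
    · exact mem_of_superset (notch_union_cell_mem_nhds.1 hz) (Set.union_subset_union_left _ hN)
    · exact mem_of_superset (notch_union_cell_mem_nhds.2 hz) (Set.union_subset_union_left _ hN)
    · filter_upwards [eventually_mem_child.2 hz,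
        h.union_mem_nhds u i hb z (openSide_child_subset.2 hz)] with w hw hw'
      exact hw'.imp .inl hw
  length := refinedSides_induction fun u i hb => by simp [h.length u i hb]
  not_planar := by
    refine refinedSides_induction fun u i hb => ?_
    obtain ⟨h1, h2, h3, h4⟩ := partner_refine_hole (h.not_planar u i hb)
    exact ⟨by rw [h1], by rw [h2], by rw [h3], by rw [h4]⟩
  partner_mem := by
    refine refinedSides_induction fun u i hb => ?_
    obtain ⟨h1, h2, h3, h4⟩ := partner_refine_hole (h.not_planar u i hb)
    have hp := h.partner_mem u i hb
    rw [h1, h2, h3, h4, show i + 1 + 4 = i + 4 + 1 by ring, show i + 5 = i + 4 + 1 by ring,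
      show i + 7 + 4 = i + 4 + 7 by ring]
    exact ⟨⟨_, _, hp, by simp⟩, ⟨_, _, hp, by simp⟩, ⟨_, _, hp, by simp⟩, ⟨_, _, hp, by simp⟩⟩
  centre_add := by
    refine refinedSides_induction fun u i hb => ?_
    obtain ⟨h1, h2, h3, h4⟩ := partner_refine_hole (h.not_planar u i hb)
    have hc := h.centre_add u i hb
    have hl := length_partner u i
    rw [h1, h2, h3, h4, show i + 5 = i + 1 + 4 by ring]
    simp only [centre, corner_add_four, hl, ← hc, smul_neg]
    refine ⟨?_, ?_, ?_, ?_⟩ <;> ring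
  isBounded := by
    rcases h.isBounded with hb | hb
    · left
      refine hb.union (isBounded_iUnion_cell.subset ?_)
      exact Set.iUnion₂_subset fun b _ z hz =>
        Set.mem_iUnion.2 ⟨b.1, mem_cell_of_mem_notch hz⟩
    · right
      exact hb.subset (Set.compl_subset_compl.2 Set.subset_union_left)

theorem cellHeight_nil (j : ZMod 8) (z : ℂ) : cellHeight [] j z = height j z := by
  simp [cellHeight, centre]

/-- The exterior of the basic octagon. -/
theorem isHole_exterior :
    IsHole 0 {z | ∃ j, 1 < cellHeight [] j z} 0 {b | b.1 = []} where
  isOpen := by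
    rw [Set.ofPred_exists]
    exact isOpen_iUnion fun j => isOpen_lt continuous_const (by fun_prop)
  nonempty := by
    obtain ⟨z, h0, -⟩ := exists_midpoint [] 0
    refine ⟨(2 : ℝ) • z, 0, ?_⟩
    rw [cellHeight_nil] at h0
    rw [cellHeight_nil, map_smul, h0]
    norm_num
  isPreconnected := by
    rw [Set.ofPred_exists]
    refine IsPreconnected.iUnion_of_reflTransGen
      (fun j => (convex_lt_cellHeight [] j 1).isPreconnected) fun i j => ?_
    have step : ∀ i : ZMod 8, ({z | 1 < cellHeight [] i z} ∩
        {z | 1 < cellHeight [] (i + 1) z}).Nonempty := by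
      intro i
      have h0 := height_corner_succ i
      have h1 := height_self (i + 1)
      refine ⟨(2 : ℝ) • corner (i + 1), ?_, ?_⟩
      · rw [Set.mem_ofPred_eq, cellHeight_nil, map_smul, h0]; norm_num
      · rw [Set.mem_ofPred_eq, cellHeight_nil, map_smul, h1]; norm_num
    have chain : ∀ k : ℕ, Relation.ReflTransGen (fun i j => ({z | 1 < cellHeight [] i z} ∩
        {z | 1 < cellHeight [] j z}).Nonempty) i (i + k) := by
      intro k
      induction k with
      | zero => simpa using Relation.ReflTransGen.refl
      | succ k ih =>
        push_cast
        rw [← add_assoc]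
        exact ih.tail (step _)
    have := chain (j - i).val
    rwa [ZMod.natCast_val, ZMod.cast_id, add_sub_cancel] at this
  notMem_cell := by
    rintro u hu z ⟨j, hj⟩ hz
    rw [List.length_eq_zero_iff] at hu
    subst hu
    exact absurd (hz j) (not_le.2 hj)
  closure_cases := by
    intro z hz
    have hc : IsClosed {z | ∃ j, 1 ≤ cellHeight [] j z} := by
      rw [Set.ofPred_exists]
      exact isClosed_iUnion_of_finite fun j => isClosed_le continuous_const (by fun_prop)
    have hsub : {z | ∃ j, 1 < cellHeight [] j z} ⊆ {z | ∃ j, 1 ≤ cellHeight [] j z} :=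
      fun z ⟨j, hj⟩ => ⟨j, hj.le⟩
    obtain ⟨j, hj⟩ := closure_minimal hsub hc hz
    by_cases h : ∃ j, 1 < cellHeight [] j z
    · exact .inl h
    · push Not at h
      exact .inr ⟨([], j), rfl, le_antisymm (h j) hj, h _, h _⟩
  reflect := by
    rintro z ⟨j, hj⟩
    refine ⟨j + 4, ?_⟩
    rw [cellHeight_reflect (u := []) rfl (by simp [centre]), cellHeight_add_four,
      cellHeight_add_four, neg_neg]
    exact hj
  union_mem_nhds := by
    rintro u i hu z -
    obtain rfl : u = [] := hu
    refine mem_of_superset univ_mem fun w _ => ?_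
    by_cases h : ∃ j, 1 < cellHeight [] j w
    · exact .inl h
    · push Not at h
      exact .inr h
  length := by
    rintro u i hu
    obtain rfl : u = [] := hu
    rfl
  not_planar := by
    rintro u i hu
    obtain rfl : u = [] := hu
    rfl
  partner_mem := by
    rintro u i hu
    obtain rfl : u = [] := hu
    rfl
  centre_add := by
    rintro u i hu
    obtain rfl : u = [] := hu
    simp [centre]
  isBounded := by
    right
    refine isBounded_iUnion_cell.subset fun z hz => Set.mem_iUnion.2 ⟨[], fun j => ?_⟩
    by_contra h
    exact hz ⟨j, not_le.1 h⟩

/-- The hole in the centre of a cell, which its eight children enclose. -/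
def centralHole (P : List (ZMod 8)) : Set ℂ :=
  {z | ∀ n, cellHeight P n z < 1 - 2 * ρ ∨ cellHeight P (n + 1) z < 1 - 2 * ρ}

theorem centralHole_subset_openCell (P : List (ZMod 8)) : centralHole P ⊆ openCell P := by
  intro z hz j
  have hρ := ratio_bounds
  have h0 := hz j
  have h7 := hz (j + 7)
  rw [show j + 7 + 1 = j by ring_nf; reduce_mod_char] at h7
  obtain ⟨-, -, -, -, -, e7⟩ := cellHeight_add P j z
  by_contra! h
  have h1 := h0.resolve_left (by linarith)
  have h7 := h7.resolve_right (by linarith)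
  nlinarith

theorem isOpen_centralHole (P : List (ZMod 8)) : IsOpen (centralHole P) := by
  unfold centralHole
  rw [Set.ofPred_forall]
  refine isOpen_iInter_of_finite fun n => ?_
  rw [Set.ofPred_or]
  exact (isOpen_lt (by fun_prop) continuous_const).union
    (isOpen_lt (by fun_prop) continuous_const)

theorem isPreconnected_centralHole (P : List (ZMod 8)) : IsPreconnected (centralHole P) := by
  have hρ := ratio_bounds
  refine (StarConvex.isPathConnected (a := centre P) ?_ ?_).isConnected.isPreconnected
  · intro z hz s t hs ht hst n
    have e : ∀ j, cellHeight P j (s • centre P + t • z) = t * cellHeight P j z := by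
      intro j
      rw [cellHeight_combo P j hst]
      simp [cellHeight]
    have aux : ∀ x < 1 - 2 * ρ, t * x < 1 - 2 * ρ := by
      intro x hx
      rcases ht.eq_or_lt with rfl | ht
      · linarith
      · nlinarith [mul_pos ht (sub_pos.2 hx)]
    rw [e, e]
    exact (hz n).imp (aux _) (aux _)
  · intro n
    simp [cellHeight]
    linarith

theorem notMem_child_of_mem_centralHole {P : List (ZMod 8)} {z : ℂ} (hz : z ∈ centralHole P)
    (n : ZMod 8) : z ∉ cell (n :: P) := by
  intro h
  obtain ⟨c0, -, -, -, -, -, -, c7⟩ := cellHeight_child n P z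
  have hρ := ratio_bounds
  have h0 := neg_one_le_cellHeight h n
  have h7 := neg_one_le_cellHeight h (n + 7)
  have := hz (n + 7)
  rw [show n + 7 + 1 = n by ring_nf; reduce_mod_char] at this
  rcases this with h' | h' <;> nlinarith

/-- Near the child `n`, only the condition for the sides `n - 1` and `n` of the parent matters. -/
theorem eventually_mem_centralHole {P : List (ZMod 8)} {n : ZMod 8} {z : ℂ}
    (h1 : cellHeight P (n + 1) z < 1 - 2 * ρ) (h3 : cellHeight P (n + 3) z < 1 - 2 * ρ)
    (h4 : cellHeight P (n + 4) z < 1 - 2 * ρ) (h6 : cellHeight P (n + 6) z < 1 - 2 * ρ) :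
    ∀ᶠ w in 𝓝 z, cellHeight P (n + 7) w < 1 - 2 * ρ ∨ cellHeight P n w < 1 - 2 * ρ →
      w ∈ centralHole P := by
  have ev : ∀ j, cellHeight P j z < 1 - 2 * ρ → ∀ᶠ w in 𝓝 z, cellHeight P j w < 1 - 2 * ρ :=
    fun j hj => (continuous_cellHeight P j).continuousAt.eventually_lt_const hj
  filter_upwards [ev _ h1, ev _ h3, ev _ h4, ev _ h6] with w h1 h3 h4 h6 h k
  rcases side_cases n k with rfl | rfl | rfl | rfl | rfl | rfl | rfl | rfl
  · exact .inr h1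
  · exact .inl h1
  · exact .inr (by rwa [add_assoc])
  · exact .inl h3
  · exact .inl h4
  · exact .inr (by rwa [add_assoc])
  · exact .inl h6
  · rwa [show n + 7 + 1 = n by ring_nf; reduce_mod_char]

/-- The sides of the child `n` on the central hole of its parent, in terms of the heights over the
parent. -/
theorem mem_side_inner {P : List (ZMod 8)} {n : ZMod 8} {z : ℂ} :
    (cellHeight P (n + 7) z = 1 - 2 * ρ → 1 - 2 * ρ ≤ cellHeight P n z →
      cellHeight P (n + 2) z ≤ 0 → z ∈ side (n :: P) (n + 3)) ∧
    (cellHeight P n z = 1 - 2 * ρ → 1 - 2 * ρ ≤ cellHeight P (n + 7) z →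
      0 ≤ cellHeight P (n + 1) z → z ∈ side (n :: P) (n + 4)) := by
  obtain ⟨-, -, c2, c3, c4, c5, -, -⟩ := cellHeight_child n P z
  have e3 := cellHeight_add_four P (n + 3) z
  rw [show n + 3 + 4 = n + 7 by ring] at e3
  have e4 := cellHeight_add_four P n z
  have e5 := cellHeight_add_four P (n + 1) z
  rw [show n + 1 + 4 = n + 5 by ring] at e5
  have hρ := ratio_pos
  have le : ∀ x : ℝ, ρ * x ≤ ρ → x ≤ 1 := fun x hx => by nlinarith
  have eq : ∀ x : ℝ, ρ * x = ρ → x = 1 := fun x hx => by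
    rw [← mul_right_inj' hρ.ne', hx, mul_one]
  refine ⟨fun h7 h0 h2 => ⟨eq _ (by linarith), ?_, ?_⟩,
    fun h0 h7 h1 => ⟨eq _ (by linarith), ?_, ?_⟩⟩
  · rw [show n + 3 + 1 = n + 4 by ring]; exact le _ (by linarith)
  · rw [show n + 3 + 7 = n + 2 by ring_nf; reduce_mod_char]; exact le _ (by linarith)
  · rw [show n + 4 + 1 = n + 5 by ring]; exact le _ (by linarith)
  · rw [show n + 4 + 7 = n + 3 by ring_nf; reduce_mod_char]; exact le _ (by linarith)

theorem centralHole_union_cell_mem_nhds {P : List (ZMod 8)} {n : ZMod 8} {z : ℂ} :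
    (z ∈ openSide (n :: P) (n + 3) → centralHole P ∪ cell (n :: P) ∈ 𝓝 z) ∧
    (z ∈ openSide (n :: P) (n + 4) → centralHole P ∪ cell (n :: P) ∈ 𝓝 z) := by
  have hρ := ratio_bounds
  have hsq := ratio_sq
  have hs : (2 - 2 * ρ) * (2 - 2 * ρ) = 2 := by linear_combination 2 * hsq
  obtain ⟨-, -, c2, c3, c4, c5, -, -⟩ := cellHeight_child n P z
  obtain ⟨e2, e3, e4, e5, e6, e7⟩ := cellHeight_add P n z
  have lt : ∀ x : ℝ, x < 1 → ρ * x < ρ := fun x hx => by nlinarith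
  have hk : (2 - 2 * ρ) * (1 - 2 * ρ) < 2 * (1 - 2 * ρ) := by nlinarith
  constructor
  · intro hz
    obtain ⟨h0, h1, h7⟩ := id hz
    rw [show n + 3 + 1 = n + 4 by ring] at h1
    rw [show n + 3 + 7 = n + 2 by ring_nf; reduce_mod_char] at h7
    rw [h0] at c3
    have y0 : cellHeight P (n + 1) z = (2 - 2 * ρ) * cellHeight P n z - (1 - 2 * ρ) := by
      linarith
    have y1 : 1 - 2 * ρ < cellHeight P n z := by linarith [lt _ h1]
    have y2 : cellHeight P (n + 2) z < 0 := by linarith [lt _ h7]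
    have y3 : cellHeight P n z < (2 - 2 * ρ) * (1 - 2 * ρ) := by
      rw [e2, y0] at y2
      linear_combination y2 - cellHeight P n z * hs
    have y4 : (2 - 2 * ρ) * cellHeight P n z < 2 * (1 - 2 * ρ) := by
      have := mul_lt_mul_of_pos_left y3 (show 0 < 2 - 2 * ρ by linarith)
      linear_combination this + (1 - 2 * ρ) * hs
    have y6 : cellHeight P (n + 6) z = (2 - 2 * ρ) * (1 - 2 * ρ) - cellHeight P n z := by
      rw [e6, y0]
      linear_combination - cellHeight P n z * hs
    filter_upwards [eventually_lt_of_mem_openSide hz, eventually_mem_centralHole (P := P) (n := n)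
      (z := z) (by linarith) (by linarith) (by linarith) (by linarith)] with w hw hw'
    rcases le_or_gt (cellHeight (n :: P) (n + 3) w) 1 with h | h
    · exact .inr (mem_cell_of_lt hw h)
    · obtain ⟨-, -, -, c3, -⟩ := cellHeight_child n P w
      have := cellHeight_add_four P (n + 3) w
      rw [show n + 3 + 4 = n + 7 by ring] at this
      exact .inl (hw' (.inl (by nlinarith)))
  · intro hz
    obtain ⟨h0, h1, h7⟩ := id hz
    rw [show n + 4 + 1 = n + 5 by ring] at h1
    rw [show n + 4 + 7 = n + 3 by ring_nf; reduce_mod_char] at h7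
    rw [h0] at c4
    have y0 : cellHeight P n z = 1 - 2 * ρ := by linarith
    rw [y0] at e3 e6
    have y1 : cellHeight P (n + 3) z < -(1 - 2 * ρ) := by linarith [lt _ h7]
    have y2 : 0 < cellHeight P (n + 1) z := by linarith [lt _ h1]
    have y6 : 0 < (2 - 2 * ρ) * cellHeight P (n + 1) z := mul_pos (by linarith) y2
    filter_upwards [eventually_lt_of_mem_openSide hz, eventually_mem_centralHole (P := P) (n := n)
      (z := z) (by linarith) (by linarith) (by linarith) (by linarith)] with w hw hw'
    rcases le_or_gt (cellHeight (n :: P) (n + 4) w) 1 with h | h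
    · exact .inr (mem_cell_of_lt hw h)
    · obtain ⟨-, -, -, -, c4, -⟩ := cellHeight_child n P w
      have := cellHeight_add_four P n w
      exact .inl (hw' (.inr (by nlinarith)))

theorem isHole_centralHole (P : List (ZMod 8)) :
    IsHole (P.length + 1) (centralHole P) (centre P)
      {b | ∃ n, b = (n :: P, n + 3) ∨ b = (n :: P, n + 4)} where
  isOpen := isOpen_centralHole P
  nonempty := by
    refine ⟨centre P, fun n => ?_⟩
    have hρ := ratio_bounds
    simp [cellHeight]
    linarith
  isPreconnected := isPreconnected_centralHole P
  notMem_cell := by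
    intro u hu z hz hzu
    obtain ⟨n, P', rfl⟩ : ∃ n P', u = n :: P' := List.exists_cons_of_ne_nil (by
      rintro rfl; simp at hu)
    have := eq_of_mem_openCell (by simpa using hu.symm) (centralHole_subset_openCell P hz)
      (cell_cons_subset n P' hzu)
    subst this
    exact notMem_child_of_mem_centralHole hz n hzu
  closure_cases := by
    intro z hz
    have hρ := ratio_bounds
    have hsq := ratio_sq
    have hc : IsClosed {z | ∀ n, cellHeight P n z ≤ 1 - 2 * ρ ∨
        cellHeight P (n + 1) z ≤ 1 - 2 * ρ} := by
      rw [Set.ofPred_forall]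
      refine isClosed_iInter fun n => ?_
      rw [Set.ofPred_or]
      exact (isClosed_le (by fun_prop) continuous_const).union
        (isClosed_le (by fun_prop) continuous_const)
    have hsub : centralHole P ⊆ {z | ∀ n, cellHeight P n z ≤ 1 - 2 * ρ ∨
        cellHeight P (n + 1) z ≤ 1 - 2 * ρ} := fun z hz n => (hz n).imp le_of_lt le_of_lt
    have hz := closure_minimal hsub hc hz
    by_cases h : z ∈ centralHole P
    · exact .inl h
    right
    simp only [centralHole, Set.mem_ofPred_eq, not_forall, not_or, not_lt] at h
    obtain ⟨n, h7, h0⟩ := h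
    obtain ⟨n, rfl⟩ : ∃ k, n = k + 7 := ⟨n + 1, by ring_nf; reduce_mod_char⟩
    rw [show n + 7 + 1 = n by ring_nf; reduce_mod_char] at h0
    have z7 := hz (n + 7)
    have z0 := hz n
    have z6 := hz (n + 6)
    rw [show n + 7 + 1 = n by ring_nf; reduce_mod_char] at z7
    rw [show n + 6 + 1 = n + 7 by ring] at z6
    obtain ⟨e2, -, -, -, e6, e7⟩ := cellHeight_add P n z
    have hs : (2 - 2 * ρ) * (2 - 2 * ρ) = 2 := by linear_combination 2 * hsq
    have hm : ∀ {x y : ℝ}, x ≤ y → (2 - 2 * ρ) * x ≤ (2 - 2 * ρ) * y := fun h =>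
      mul_le_mul_of_nonneg_left h (by linarith)
    have hk : 0 ≤ (1 - 2 * ρ) * (2 * ρ) := mul_nonneg (by linarith) (by linarith)
    rcases z7 with z7 | z7
    · refine ⟨_, ⟨n, .inl rfl⟩, mem_side_inner.1 (le_antisymm z7 h7) h0 ?_⟩
      have e : (2 - 2 * ρ) * cellHeight P (n + 1) z =
          2 * cellHeight P n z - (2 - 2 * ρ) * (1 - 2 * ρ) := by
        rw [← le_antisymm z7 h7, e7]; linear_combination cellHeight P n z * hs
      rcases z0 with z0 | z0
      · linarith
      · linarith [hm z0]
    · refine ⟨_, ⟨n, .inr rfl⟩, mem_side_inner.2 (le_antisymm z7 h0) h7 ?_⟩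
      have e : cellHeight P n z = 1 - 2 * ρ := le_antisymm z7 h0
      rcases z6 with z6 | z6
      · rw [e] at e6
        exact le_of_mul_le_mul_left (show (2 - 2 * ρ) * 0 ≤ _ by linarith) (by linarith)
      · rw [e] at e7
        linarith
  reflect := by
    intro z hz n
    have h := hz (n + 4)
    have hl : centre P + centre P = 2 * centre P := by ring
    rw [cellHeight_reflect rfl hl, cellHeight_reflect rfl hl,
      show n + 1 + 4 = n + 4 + 1 by ring]
    exact h
  union_mem_nhds := by
    rintro u i ⟨n, h | h⟩ z hz <;> cases h
    · exact centralHole_union_cell_mem_nhds.1 hz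
    · exact centralHole_union_cell_mem_nhds.2 hz
  length := by
    rintro u i ⟨n, h | h⟩ <;> cases h <;> simp
  not_planar := by
    rintro u i ⟨n, h | h⟩ <;> cases h
    · rw [partner_three]
    · rw [partner_four]
  partner_mem := by
    rintro u i ⟨n, h | h⟩ <;> cases h
    · rw [partner_three]; exact ⟨n + 4, .inl (by rw [add_right_comm])⟩
    · rw [partner_four]; exact ⟨n + 4, .inr rfl⟩
  centre_add := by
    rintro u i ⟨n, h | h⟩ <;> cases h
    · rw [partner_three]; simp only [centre, corner_add_four, smul_neg]; ring
    · rw [partner_four]; simp only [centre, corner_add_four, smul_neg]; ring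
  isBounded := .inl (isBounded_iUnion_cell.subset fun _ hz =>
    Set.mem_iUnion.2 ⟨P, openCell_subset_cell P (centralHole_subset_openCell P hz)⟩)

section planar

variable {A : List (ZMod 8)} {i : ZMod 8}

/-- The heights over two cells with a common side. -/
theorem cellHeight_partner (h : (partner A i).1 = true) (z : ℂ) :
    cellHeight (partner A i).2 (i + 4) z = 2 - cellHeight A i z ∧
    cellHeight (partner A i).2 (i + 5) z = 2 - 2 * ρ - cellHeight A (i + 1) z ∧
    cellHeight (partner A i).2 (i + 3) z = 2 - 2 * ρ - cellHeight A (i + 7) z := by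
  have key := fun j => cellHeight_sub (length_partner A i).symm (centre_partner_planar h) j z
  have e8 := height_corner_succ i
  obtain ⟨c0, c1, -, -, -, -, -, c7⟩ := height_corner i
  have d1 := height_self (i + 1)
  have d7 := (height_corner (i + 1)).2.2.2.2.2.2.1
  rw [show i + 1 + 6 = i + 7 by ring] at d7
  refine ⟨?_, ?_, ?_⟩
  · rw [cellHeight_add_four, key, map_add, c0, e8]; ring
  · rw [show i + 5 = i + 1 + 4 by ring, cellHeight_add_four, key, map_add, c1, d1]; ring
  · rw [show i + 3 = i + 7 + 4 by ring_nf; reduce_mod_char, cellHeight_add_four, key, map_add, c7,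
      d7]; ring

theorem side_partner (h : (partner A i).1 = true) : side (partner A i).2 (i + 4) = side A i := by
  ext z
  obtain ⟨h0, h1, h7⟩ := cellHeight_partner h z
  obtain ⟨-, -, -, -, -, e7⟩ := cellHeight_add A i z
  simp only [side, Set.mem_ofPred_eq, show i + 4 + 1 = i + 5 by ring,
    show i + 4 + 7 = i + 3 by ring_nf; reduce_mod_char, h0, h1, h7]
  constructor
  · rintro ⟨g0, g1, g7⟩
    have : cellHeight A i z = 1 := by linarith
    rw [this] at e7
    exact ⟨this, by linarith, by linarith⟩
  · rintro ⟨g0, g1, g7⟩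
    rw [g0] at e7
    exact ⟨by linarith, by linarith, by linarith⟩

theorem partner_union_mem_nhds (h : (partner A i).1 = true) {z : ℂ} (hz : z ∈ openSide A i) :
    cell (partner A i).2 ∪ cell A ∈ 𝓝 z := by
  have hz' : z ∈ openSide (partner A i).2 (i + 4) := by
    obtain ⟨h0, h1, h7⟩ := cellHeight_partner h z
    obtain ⟨-, -, -, -, -, e7⟩ := cellHeight_add A i z
    obtain ⟨g0, g1, g7⟩ := hz
    rw [g0] at e7 h0
    refine ⟨by linarith, ?_, ?_⟩
    · rw [show i + 4 + 1 = i + 5 by ring]; linarith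
    · rw [show i + 4 + 7 = i + 3 by ring_nf; reduce_mod_char]; linarith
  filter_upwards [eventually_lt_of_mem_openSide hz, eventually_lt_of_mem_openSide hz'] with w hw hw'
  rcases le_or_gt (cellHeight A i w) 1 with h' | h'
  · exact .inr (mem_cell_of_lt hw h')
  · refine .inl (mem_cell_of_lt hw' ?_)
    have := (cellHeight_partner h w).1
    linarith

/-- The hole between two cells with a common side: it consists of the two notches in this side. -/
def gap (A : List (ZMod 8)) (i : ZMod 8) : Set ℂ := notch A i ∪ notch (partner A i).2 (i + 4)

theorem gap_eq (h : (partner A i).1 = true) : gap A i =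
    ({z | 2 * ρ < cellHeight A (i + 1) z} ∩ {z | cellHeight A (i + 1) z < 2 - 4 * ρ}) ∩
    ({z | 2 * ρ < cellHeight A (i + 7) z} ∩ {z | cellHeight A (i + 7) z < 2 - 4 * ρ}) := by
  ext z
  obtain ⟨h0, h1, h7⟩ := cellHeight_partner h z
  constructor
  · rintro (hz | hz)
    · obtain ⟨-, b1, b7⟩ := notch_bounds hz
      exact ⟨⟨hz.2.1, b1⟩, ⟨hz.2.2, b7⟩⟩
    · obtain ⟨-, b1, b7⟩ := notch_bounds hz
      obtain ⟨-, g1, g7⟩ := hz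
      rw [show i + 4 + 1 = i + 5 by ring] at b1 g1
      rw [show i + 4 + 7 = i + 3 by ring_nf; reduce_mod_char] at b7 g7
      refine ⟨⟨?_, ?_⟩, ?_, ?_⟩ <;> rw [Set.mem_ofPred_eq] <;> linarith
  · rintro ⟨⟨g1, g1'⟩, g7, g7'⟩
    rw [Set.mem_ofPred_eq] at g1 g1' g7 g7'
    rcases le_or_gt (cellHeight A i z) 1 with h' | h'
    · exact .inl ⟨h', g1, g7⟩
    · refine .inr ⟨by linarith, ?_, ?_⟩
      · rw [show i + 4 + 1 = i + 5 by ring]; linarith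
      · rw [show i + 4 + 7 = i + 3 by ring_nf; reduce_mod_char]; linarith

theorem notMem_cell_of_mem_notch_planar (h : (partner A i).1 = true) {z : ℂ} (hz : z ∈ notch A i)
    {u : List (ZMod 8)} (hu : u.length = A.length + 1) : z ∉ cell u := by
  intro hzu
  obtain ⟨n, P, rfl⟩ : ∃ n P, u = n :: P := List.exists_cons_of_ne_nil (by
    rintro rfl; simp at hu)
  have hl : P.length = A.length := by simpa using hu
  have hzP := cell_cons_subset n P hzu
  have hPA : P ≠ A := by
    rintro rfl
    exact notMem_child_of_mem_notch hz n hzu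
  rcases mem_openCell_or_openSide_of_mem_notch hz with h' | h'
  · exact hPA (eq_of_mem_openCell hl.symm h' hzP).symm
  · obtain rfl : (partner A i).2 = P := by
      by_contra hP
      refine hPA (eq_of_union_mem_nhds hl (partner_union_mem_nhds h h') (fun w hw hw' => hP ?_) hzP)
      exact (eq_of_mem_openCell (hl.trans (length_partner A i).symm) hw' hw).symm
    -- A point on the common side lies in the notch of the other cell as well.
    have hz' : z ∈ notch (partner A i).2 (i + 4) := by
      obtain ⟨h0, h1, h7⟩ := cellHeight_partner h z
      obtain ⟨-, b1, b7⟩ := notch_bounds hz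
      refine ⟨by rw [h0, h'.1]; norm_num, ?_, ?_⟩
      · rw [show i + 4 + 1 = i + 5 by ring]; linarith
      · rw [show i + 4 + 7 = i + 3 by ring_nf; reduce_mod_char]; linarith
    exact notMem_child_of_mem_notch hz' n hzu

/-- The sides on the boundary of `gap A i`, two for each of the two notches. -/
def gapSides (A : List (ZMod 8)) (i : ZMod 8) : Set (List (ZMod 8) × ZMod 8) :=
  {(i :: A, i + 1), ((i + 1) :: A, i + 7), ((i + 4) :: (partner A i).2, i + 5),
    ((i + 5) :: (partner A i).2, i + 3)}

theorem gapSides_induction {Q : List (ZMod 8) → ZMod 8 → Prop}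
    (h : ∀ A' i', (A' = A ∧ i' = i ∨ A' = (partner A i).2 ∧ i' = i + 4) →
      Q (i' :: A') (i' + 1) ∧ Q ((i' + 1) :: A') (i' + 7)) :
    ∀ v j, (v, j) ∈ gapSides A i → Q v j := by
  have h1 := h A i (.inl ⟨rfl, rfl⟩)
  have h2 := h (partner A i).2 (i + 4) (.inr ⟨rfl, rfl⟩)
  rw [show i + 4 + 1 = i + 5 by ring, show i + 4 + 7 = i + 3 by ring_nf; reduce_mod_char] at h2
  rintro v j (h' | h' | h' | h') <;> cases h'
  exacts [h1.1, h1.2, h2.1, h2.2]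

/-- A common side of two cells lies on no hole, but in the next level a hole appears there. -/
theorem isHole_gap (h : (partner A i).1 = true) :
    IsHole (A.length + 1) (gap A i) ((centre A + centre (partner A i).2) / 2) (gapSides A i) := by
  have hsym := partner_symm A i
  rw [h] at hsym
  have e44 : i + 4 + 4 = i := by ring_nf; reduce_mod_char
  have hl := length_partner A i
  have hc : centre A + centre (partner A i).2 =
      2 * ((centre A + centre (partner A i).2) / 2) := by ring
  have notch_sub : ∀ A' i', (A' = A ∧ i' = i ∨ A' = (partner A i).2 ∧ i' = i + 4) →
      notch A' i' ⊆ gap A i := by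
    rintro A' i' (⟨rfl, rfl⟩ | ⟨rfl, rfl⟩)
    · exact Set.subset_union_left
    · exact Set.subset_union_right
  -- The four sides on the boundary of the gap are glued in pairs.
  have hpart : ∀ A' i', (A' = A ∧ i' = i ∨ A' = (partner A i).2 ∧ i' = i + 4) →
      (partner A' i').1 = true ∧ A'.length = A.length ∧
      centre A' + centre (partner A' i').2 = centre A + centre (partner A i).2 ∧
      ((partner A' i').2 = A ∧ i' + 4 = i ∨
        (partner A' i').2 = (partner A i).2 ∧ i' + 4 = i + 4) := by
    rintro A' i' (⟨rfl, rfl⟩ | ⟨rfl, rfl⟩)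
    · exact ⟨h, rfl, rfl, .inr ⟨rfl, rfl⟩⟩
    · rw [hsym]
      exact ⟨rfl, hl, add_comm _ _, .inl ⟨rfl, e44⟩⟩
  exact {
    isOpen := by
      rw [gap_eq h]
      exact ((isOpen_lt continuous_const (by fun_prop)).inter
        (isOpen_lt (by fun_prop) continuous_const)).inter
        ((isOpen_lt continuous_const (by fun_prop)).inter
        (isOpen_lt (by fun_prop) continuous_const))
    nonempty := by
      obtain ⟨z, h0, h1, h7⟩ := exists_midpoint A i
      have hρ := ratio_bounds
      exact ⟨z, .inl ⟨h0.le, by linarith, by linarith⟩⟩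
    isPreconnected := by
      rw [gap_eq h]
      exact (((convex_lt_cellHeight _ _ _).inter (convex_cellHeight_lt _ _ _)).inter
        ((convex_lt_cellHeight _ _ _).inter (convex_cellHeight_lt _ _ _))).isPreconnected
    notMem_cell := by
      rintro u hu z (hz | hz)
      · exact notMem_cell_of_mem_notch_planar h hz hu
      · exact notMem_cell_of_mem_notch_planar (by rw [hsym]) hz (by rw [hl, hu])
    closure_cases := by
      intro z hz
      rw [gap, closure_union] at hz
      rcases hz with hz | hz
      · obtain ⟨h0, h1, h7⟩ := closure_notch_subset _ _ hz
        rcases mem_closure_notch_cases h0 h1 h7 with h' | h' | h'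
        · exact .inl (.inl h')
        · exact .inr ⟨(_, _), .inl rfl, h'⟩
        · exact .inr ⟨(_, _), .inr (.inl rfl), h'⟩
      · obtain ⟨h0, h1, h7⟩ := closure_notch_subset _ _ hz
        rcases mem_closure_notch_cases h0 h1 h7 with h' | h' | h'
        · exact .inl (.inr h')
        · rw [show i + 4 + 1 = i + 5 by ring] at h'
          exact .inr ⟨(_, _), .inr (.inr (.inl rfl)), h'⟩
        · rw [show i + 4 + 1 = i + 5 by ring,
            show i + 4 + 7 = i + 3 by ring_nf; reduce_mod_char] at h'
          exact .inr ⟨(_, _), .inr (.inr (.inr rfl)), h'⟩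
    reflect := by
      rintro z (hz | hz)
      · exact .inr (notch_reflect hl.symm hc hz)
      · have := notch_reflect hl ((add_comm _ _).trans hc) hz
        rw [e44] at this
        exact .inl this
    union_mem_nhds := gapSides_induction fun A' i' hA =>
      ⟨fun z hz => mem_of_superset (notch_union_cell_mem_nhds.1 hz)
        (Set.union_subset_union_left _ (notch_sub A' i' hA)),
      fun z hz => mem_of_superset (notch_union_cell_mem_nhds.2 hz)
        (Set.union_subset_union_left _ (notch_sub A' i' hA))⟩
    length := gapSides_induction fun A' i' hA => by simp [(hpart A' i' hA).2.1]
    not_planar := by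
      refine gapSides_induction fun A' i' hA => ?_
      obtain ⟨-, h2, h3, -⟩ := partner_refine_planar (hpart A' i' hA).1
      exact ⟨by rw [h2], by rw [h3]⟩
    partner_mem := by
      refine gapSides_induction fun A' i' hA => ?_
      obtain ⟨hp, -, -, hA'⟩ := hpart A' i' hA
      obtain ⟨-, h2, h3, -⟩ := partner_refine_planar hp
      rw [h2, h3, show i' + 1 + 4 = i' + 4 + 1 by ring, show i' + 7 + 4 = i' + 4 + 7 by ring,
        show i' + 5 = i' + 4 + 1 by ring]
      rcases hA' with ⟨e1, e2⟩ | ⟨e1, e2⟩ <;> rw [e1, e2]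
      · exact ⟨by simp [gapSides], by simp [gapSides]⟩
      · rw [show i + 4 + 1 = i + 5 by ring, show i + 4 + 7 = i + 3 by ring_nf; reduce_mod_char]
        exact ⟨by simp [gapSides], by simp [gapSides]⟩
    centre_add := by
      refine gapSides_induction fun A' i' hA => ?_
      obtain ⟨hp, hl', hc', -⟩ := hpart A' i' hA
      obtain ⟨-, h2, h3, -⟩ := partner_refine_planar hp
      have hl'' := length_partner A' i'
      rw [h2, h3, ← hc, ← hc', show i' + 5 = i' + 1 + 4 by ring]
      simp only [centre, corner_add_four, hl'', smul_neg]
      constructor <;> ring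
    isBounded := .inl (isBounded_iUnion_cell.subset (by
      rintro z (hz | hz)
      · exact Set.mem_iUnion.2 ⟨_, mem_cell_of_mem_notch hz⟩
      · exact Set.mem_iUnion.2 ⟨_, mem_cell_of_mem_notch hz⟩)) }

end planar

/-- Every side that is not common to two cells lies on the boundary of a hole. -/
theorem exists_isHole {u : List (ZMod 8)} {i : ZMod 8} (h : (partner u i).1 = false) :
    ∃ O p B, IsHole u.length O p B ∧ (u, i) ∈ B := by
  induction u generalizing i with
  | nil => exact ⟨_, _, _, isHole_exterior, rfl⟩
  | cons n P ih =>
    have e : n + 7 + 1 = n := by ring_nf; reduce_mod_char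
    rcases side_cases n i with rfl | rfl | rfl | rfl | rfl | rfl | rfl | rfl
    · cases hP : (partner P i).1
      · obtain ⟨O, p, B, hO, hB⟩ := ih hP
        exact ⟨_, _, _, hO.succ, P, i, hB, by simp⟩
      · simp [partner_zero, hP] at h
    · cases hP : (partner P n).1
      · obtain ⟨O, p, B, hO, hB⟩ := ih hP
        exact ⟨_, _, _, hO.succ, P, n, hB, by simp⟩
      · exact ⟨_, _, _, isHole_gap hP, by simp [gapSides]⟩
    · simp [partner_two] at h
    · exact ⟨_, _, _, isHole_centralHole P, n, .inl rfl⟩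
    · exact ⟨_, _, _, isHole_centralHole P, n, .inr rfl⟩
    · simp [partner_five] at h
    · cases hP : (partner P (n + 7)).1
      · obtain ⟨O, p, B, hO, hB⟩ := ih hP
        refine ⟨_, _, _, hO.succ, P, n + 7, hB, .inr (.inr (.inl ?_))⟩
        rw [e, show n + 7 + 7 = n + 6 by ring_nf; reduce_mod_char]
      · refine ⟨_, _, _, isHole_gap hP, .inr (.inl ?_)⟩
        rw [e, show n + 7 + 7 = n + 6 by ring_nf; reduce_mod_char]
    · cases hP : (partner P (n + 7)).1
      · obtain ⟨O, p, B, hO, hB⟩ := ih hP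
        refine ⟨_, _, _, hO.succ, P, n + 7, hB, .inr (.inr (.inr ?_))⟩
        rw [e]
      · simp [partner_seven, hP] at h

/-! ### The cell graph -/

/-- A bounded set is not invariant under a translation. -/
theorem eq_zero_of_add_mem {S : Set ℂ} (hS : Bornology.IsBounded S)
    (hne : S.Nonempty) {d : ℂ} (hd : ∀ z ∈ S, z + d ∈ S) : d = 0 := by
  obtain ⟨z, hz⟩ := hne
  obtain ⟨R, hR⟩ := isBounded_iff_forall_norm_le.1 hS
  have key : ∀ n : ℕ, z + n * d ∈ S := by
    intro n
    induction n with
    | zero => simpa using hz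
    | succ n ih =>
      have := hd _ ih
      rwa [show z + n * d + d = z + ((n + 1 : ℕ) : ℂ) * d by push_cast; ring] at this
  by_contra h0
  obtain ⟨n, hn⟩ := exists_nat_gt ((R + ‖z‖) / ‖d‖)
  rw [div_lt_iff₀ (norm_pos_iff.2 h0)] at hn
  have h1 : ‖(n : ℂ) * d‖ ≤ ‖z + n * d‖ + ‖z‖ := by
    simpa using norm_sub_le (z + n * d) z
  rw [norm_mul, Complex.norm_natCast] at h1
  linarith [hR _ (key n)]

namespace IsHole

variable {m : ℕ} {O : Set ℂ} {p : ℂ} {B : Set (List (ZMod 8) × ZMod 8)}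

theorem subset_compl_region (h : IsHole m O p B) : O ⊆ (region m)ᶜ := by
  intro z hz hr
  obtain ⟨u, hu, hzu⟩ := mem_region.1 hr
  exact h.notMem_cell u hu z hz hzu

/-- A hole is a component of the complement: it is connected and open, and its boundary lies in the
region. -/
theorem connectedComponentIn_eq (h : IsHole m O p B) {x : ℂ} (hx : x ∈ O) :
    connectedComponentIn (region m)ᶜ x = O := by
  apply Set.Subset.antisymm
  · refine IsPreconnected.subset_left_of_subset_union h.isOpen isClosed_closure.isOpen_compl
      (Set.disjoint_compl_right_iff_subset.2 subset_closure) ?_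
      ⟨x, mem_connectedComponentIn (h.subset_compl_region hx), hx⟩
      isPreconnected_connectedComponentIn
    intro z hz
    by_cases hc : z ∈ closure O
    · rcases h.closure_cases z hc with hO | ⟨⟨u, i⟩, hb, hs⟩
      · exact .inl hO
      · exact absurd (mem_region.2 ⟨u, h.length u i hb, side_subset_cell u i hs⟩)
          (connectedComponentIn_subset _ _ hz)
    · exact .inr hc
  · exact h.isPreconnected.subset_connectedComponentIn hx h.subset_compl_region

theorem side_subset_frontier (h : IsHole m O p B) {u : List (ZMod 8)} {i : ZMod 8}
    (hb : (u, i) ∈ B) : side u i ⊆ frontier O := by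
  intro z hz
  rw [h.isOpen.frontier_eq]
  exact ⟨closure_minimal (h.openSide_subset_closure hb) isClosed_closure
    (side_subset_closure_openSide u i hz),
    fun hO => h.notMem_cell u (h.length u i hb) z hO (side_subset_cell u i hz)⟩

theorem reflect_image (h : IsHole m O p B) : (fun z => 2 * p - z) '' O = O := by
  apply Set.Subset.antisymm
  · rintro _ ⟨z, hz, rfl⟩
    exact h.reflect z hz
  · exact fun z hz => ⟨2 * p - z, h.reflect z hz, by simp⟩

/-- The centre of symmetry of a hole is unique: otherwise the hole would be invariant under a
translation, but the hole or its complement is bounded. -/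
theorem eq_of_reflect_image (h : IsHole m O p B) (hB : B.Nonempty) {q : ℂ}
    (hq : (fun z => 2 * q - z) '' O = O) : q = p := by
  have hq' : ∀ z ∈ O, 2 * q - z ∈ O := fun z hz => hq ▸ ⟨z, hz, rfl⟩
  have e : 2 * (q - p) = 0 := by
    rcases h.isBounded with hb | hb
    · refine eq_zero_of_add_mem hb h.nonempty fun z hz => ?_
      have := hq' _ (h.reflect z hz)
      rwa [show 2 * q - (2 * p - z) = z + 2 * (q - p) by ring] at this
    · refine eq_zero_of_add_mem hb ?_ fun z hz hz' => hz ?_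
      · obtain ⟨⟨u, i⟩, hb⟩ := hB
        obtain ⟨z, hz⟩ := openSide_nonempty u i
        exact ⟨z, fun hO => h.notMem_cell u (h.length u i hb) z hO
          (side_subset_cell u i (openSide_subset_side u i hz))⟩
      · have := h.reflect _ (hq' _ hz')
        rwa [show 2 * p - (2 * q - (z + 2 * (q - p))) = z by ring] at this
  simpa [sub_eq_zero] using e

end IsHole

theorem side_reflect_image {u v : List (ZMod 8)} (hl : u.length = v.length) {p : ℂ}
    (h : centre u + centre v = 2 * p) (i : ZMod 8) :
    (fun z => 2 * p - z) '' side u i = side v (i + 4) := by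
  apply Set.Subset.antisymm
  · rintro _ ⟨z, hz, rfl⟩
    exact side_reflect hl h hz
  · intro z hz
    have := side_reflect hl.symm ((add_comm _ _).trans h) hz
    rw [show i + 4 + 4 = i by ring_nf; reduce_mod_char] at this
    exact ⟨2 * p - z, this, by simp⟩

/-- A point in the relative interior of a side belongs to the cell itself and, if the side is a
common side of two cells, to the other one. -/
theorem eq_or_eq_partner {u v : List (ZMod 8)} (hl : v.length = u.length) {i : ZMod 8} {z : ℂ}
    (hz : z ∈ openSide u i) (hv : z ∈ cell v) :
    v = u ∨ (partner u i).1 = true ∧ v = (partner u i).2 := by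
  cases h : (partner u i).1
  · obtain ⟨O, p, B, hO, hB⟩ := exists_isHole h
    exact .inl (eq_of_union_mem_nhds hl (hO.union_mem_nhds u i hB z hz)
      (fun w hw hw' => hO.notMem_cell v hl w hw (openCell_subset_cell v hw')) hv)
  · by_cases hp : v = (partner u i).2
    · exact .inr ⟨rfl, hp⟩
    · exact .inl (eq_of_union_mem_nhds hl (partner_union_mem_nhds h hz)
        (fun w hw hw' => hp (eq_of_mem_openCell (hl.trans (length_partner u i).symm) hw' hw)) hv)

/-- Adjacent cells are linked. If a side is identified antipodally, the component in question is the
hole on which this side lies, and the reflection is that of the hole, since there is no other one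
that preserves it. -/
theorem linked_of_adj {m : ℕ} {u v : Fin m → ZMod 8} (h : (cellGraph m).Adj u v) :
    Linked (code u) (code v) := by
  obtain ⟨hne, i, j, h⟩ := h
  have hne : code v ≠ code u := fun e => hne (code_injective e).symm
  have hl : (code v).length = (code u).length := by simp
  obtain ⟨z, hz⟩ := openSide_nonempty (code u) i
  have hzs := openSide_subset_side _ _ hz
  rcases h with h | ⟨x, hx, p, he, he', hC, h⟩
  · rw [cellSide_eq, cellSide_eq] at h
    rw [h] at hzs
    rcases eq_or_eq_partner hl hz (side_subset_cell _ _ hzs) with h' | ⟨-, h'⟩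
    · exact absurd h' hne
    · exact ⟨i, h'.symm⟩
  · rw [cellSide_eq] at he he' h
    rw [cellSide_eq] at h
    set C := connectedComponentIn (region m)ᶜ x with hCdef
    have hzC : z ∈ closure C := frontier_subset_closure (he hzs)
    have hCm : ∀ w ∈ C, ∀ u : List (ZMod 8), u.length = m → w ∉ cell u := fun w hw u hu hwu =>
      connectedComponentIn_subset _ _ hw (mem_region.2 ⟨u, hu, hwu⟩)
    cases hp : (partner (code u) i).1
    · obtain ⟨O, p', B, hO, hB⟩ := exists_isHole hp
      rw [length_code] at hO
      obtain ⟨w, hw, hwC⟩ := mem_closure_iff_nhds.1 hzC _ (hO.union_mem_nhds _ i hB z hz)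
      have hwO : w ∈ O := hw.resolve_right (hCm w hwC _ (length_code u))
      have hCO : C = O := by
        rw [hCdef, connectedComponentIn_eq hwC, hO.connectedComponentIn_eq hwO]
      rw [hCO] at hC
      obtain rfl := hO.eq_of_reflect_image ⟨_, hB⟩ hC
      have hlp := length_partner (code u) i
      have hz' := openSide_reflect hlp.symm (hO.centre_add _ i hB) hz
      have hzv : 2 * p - z ∈ cell (code v) := by
        refine side_subset_cell (code v) j ?_
        rw [← h]
        exact ⟨z, hzs, rfl⟩
      rcases eq_or_eq_partner (hl.trans hlp.symm) hz' hzv with h' | ⟨h', -⟩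
      · exact ⟨i, h'.symm⟩
      · rw [partner_symm, hp] at h'
        cases h'
    · obtain ⟨w, hw, hwC⟩ := mem_closure_iff_nhds.1 hzC _ (partner_union_mem_nhds hp hz)
      rcases hw with hw | hw
      · exact absurd hw (hCm w hwC _ (by rw [length_partner, length_code]))
      · exact absurd hw (hCm w hwC _ (length_code u))

theorem adj_of_linked {m : ℕ} {u v : Fin m → ZMod 8} (hne : u ≠ v)
    (h : Linked (code u) (code v)) : (cellGraph m).Adj u v := by
  obtain ⟨i, hi⟩ := h
  refine ⟨hne, i, i + 4, ?_⟩
  rw [cellSide_eq, cellSide_eq, ← hi]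
  cases hp : (partner (code u) i).1
  · right
    obtain ⟨O, p, B, hO, hB⟩ := exists_isHole hp
    rw [length_code] at hO
    obtain ⟨x, hx⟩ := hO.nonempty
    refine ⟨x, hO.subset_compl_region hx, p, ?_⟩
    rw [hO.connectedComponentIn_eq hx]
    exact ⟨hO.side_subset_frontier hB, hO.side_subset_frontier (hO.partner_mem _ i hB),
      hO.reflect_image, side_reflect_image (length_partner _ i).symm (hO.centre_add _ i hB) i⟩
  · exact .inl (side_partner hp).symm

/-- A chain of links is a walk in the cell graph, in which equal consecutive cells are dropped. -/
theorem exists_walk_of_near {m k : ℕ} {x y : List (ZMod 8)} (h : Near k x y) :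
    ∀ u v : Fin m → ZMod 8, code u = x → code v = y →
      ∃ w : (cellGraph m).Walk u v, w.length ≤ k := by
  induction h with
  | refl k x =>
    rintro u v rfl hv
    obtain rfl := code_injective hv
    exact ⟨.nil, by simp⟩
  | @head k x y z hl hn ih =>
    rintro u v rfl rfl
    obtain ⟨w, rfl⟩ := exists_code (hl.length_eq.trans (length_code u))
    obtain ⟨W, hW⟩ := ih w v rfl rfl
    by_cases huw : u = w
    · subst huw
      exact ⟨W, by omega⟩
    · exact ⟨.cons (adj_of_linked huw hl) W, by simpa using hW⟩

theorem near_of_walk {m : ℕ} {u v : Fin m → ZMod 8} (w : (cellGraph m).Walk u v) :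
    Near w.length (code u) (code v) := by
  induction w with
  | nil => exact .refl _ _
  | cons h _ ih => exact .head (linked_of_adj h) ih

/-- The crude bound, for all words of length `m + 1`. -/
theorem near_code {m : ℕ} (u v : Fin (m + 1) → ZMod 8) :
    Near (7 * 2 ^ m - 3) (code u) (code v) := by
  rw [code_succ, code_succ]
  have := near_of_length_eq (u := code (Fin.tail u)) (v := code (Fin.tail v)) (by simp) (u 0) (v 0)
  rwa [length_code] at this

theorem cellGraph_connected (m : ℕ) : (cellGraph (m + 1)).Connected :=
  ⟨fun u v => let ⟨w, _⟩ := exists_walk_of_near (near_code u v) u v rfl rfl; ⟨w⟩⟩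

theorem dist_le_of_near {m k : ℕ} {u v : Fin m → ZMod 8} (h : Near k (code u) (code v)) :
    (cellGraph m).dist u v ≤ k :=
  let ⟨w, hw⟩ := exists_walk_of_near h u v rfl rfl
  (SimpleGraph.dist_le w).trans hw

theorem code_eq_cons {m : ℕ} (u : Fin (m + 1) → ZMod 8) :
    code u = u (Fin.last m) :: code (Fin.init u) := by
  rw [code, List.ofFn_succ']
  rw [List.concat_eq_append, List.reverse_append]
  rfl

/-- The estimate for the level `m + 1`. -/
theorem cellGraph_diam_succ_le (m : ℕ) : (cellGraph (m + 2)).diam ≤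
    2 * (cellGraph (m + 1)).diam + 2 ^ (m + 1) + 1 := by
  have hconn := cellGraph_connected m
  have htop : (cellGraph (m + 1)).ediam ≠ ⊤ := SimpleGraph.connected_iff_ediam_ne_top.1 hconn
  obtain ⟨a, b, hab⟩ := (cellGraph (m + 1)).exists_dist_eq_diam
  have hdiam : (cellGraph (m + 1)).diam ≤ 7 * 2 ^ m - 3 := hab ▸ dist_le_of_near (near_code a b)
  obtain ⟨u, v, huv⟩ := (cellGraph (m + 2)).exists_dist_eq_diam
  obtain ⟨w, hw⟩ := hconn.exists_walk_length_eq_dist (Fin.init u) (Fin.init v)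
  have hL : w.length ≤ (cellGraph (m + 1)).diam := hw ▸ SimpleGraph.dist_le_diam htop
  obtain ⟨delay, hd, hn⟩ := near_child_of_near
    (by intro h; simpa using congrArg List.length h) (near_of_walk w) (u (Fin.last _))
    (v (Fin.last _))
  rw [← code_eq_cons, ← code_eq_cons] at hn
  have := dist_le_of_near hn
  have := Nat.one_le_two_pow (n := m)
  rw [huv] at *
  rw [pow_succ]
  -- `4 * delay ≤ L + 3 ≤ 7 * 2 ^ m`, so that `delay < 2 ^ (m + 1)`.
  omega

end ProjectiveOctagasket

theorem proposition9p2 (m : ℕ) (hm : 0 < m) :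
    (ProjectiveOctagasket.cellGraph m).Connected ∧
    (ProjectiveOctagasket.cellGraph (m + 1)).Connected ∧
    (ProjectiveOctagasket.cellGraph (m + 1)).diam ≤
      2 * (ProjectiveOctagasket.cellGraph m).diam + 2 ^ m + 1 := by
  obtain ⟨m, rfl⟩ := Nat.exists_eq_succ_of_ne_zero hm.ne'
  exact ⟨ProjectiveOctagasket.cellGraph_connected m,
    ProjectiveOctagasket.cellGraph_connected (m + 1),
    ProjectiveOctagasket.cellGraph_diam_succ_le m⟩
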